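/- Let $k\ge 1$ and let $F$ be a forest of $k$ stars $S_1,\dots,S_k$ with $1\le e(S_1)\le\dots\le e(S_k)$ edges. A copy of $F$ in an edge-coloured graph is rainbow if its edges have pairwise distinct colours. An $n$-vertex graph is called extremal (for $n$ and $F$) if it has a proper edge-colouring with no rainbow copy of $F$ and it has the maximum number of edges among all $n$-vertex graphs that have such a colouring. For $0\le c\le k-1$ put $f(c)=\left(\sum_{i=1}^{k-c}e(S_i)\right)-1$. Write $H_F(n,c)$ for any graph obtained from $c$ universal vertices (each joined to every other vertex) and a graph $H$ on the remaining $n-c$ vertices, where, if $c=k-1$, $H$ has the maximum number of edges among graphs on $n-c$ vertices of maximum degree at most $f(k-1)=e(S_1)-1$, and, if $c\le k-2$, $H$ has the maximum number of edges among graphs on $n-c$ vertices that have a proper edge-colouring with $f(c)$ colours. (For given $n$, $F$ and $c$ all graphs $H_F(n,c)$ have the same number of edges.) There is $N=N(F)$ such that the following holds for all $n\ge N$ and all $n$-vertex graphs $G$. (a) If $G$ is extremal, then $G$ is isomorphic to an $H_F(n,c)$ for some $0\le c\le k-1$. (b) Suppose that $F$ has no star with exactly one edge. Then $G$ is extremal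 if and only if $G$ is isomorphic to an $H_F(n,0)$, or $k\ge 2$, $n$ is odd, all stars of $F$ have exactly two edges, and $G$ is isomorphic to an $H_F(n,1)$. (c) Suppose that $F$ has a star with exactly one edge. Then $G$ is extremal if and only if $G$ has at least as many edges as each $H_F(n,0)$ and each $H_F(n,k-1)$, and moreover $G$ is isomorphic to an $H_F(n,0)$ or to an $H_F(n,k-1)$, or else $k\ge 3$, $n$ is odd, one star of $F$ has exactly one edge, the other $k-1$ have exactly two edges, and $G$ is isomorphic to an $H_F(n,1)$. -/

import Mathlib

namespace RainbowStars

open SimpleGraph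

/-- The disjoint union of the stars `S_i`, where `S_i` has `s i` edges: its vertices are the pairs
`⟨i, j⟩` with `0 ≤ j ≤ s i`, and `⟨i, 0⟩` is the centre of `S_i`. -/
def starForest {k : ℕ} (s : Fin k → ℕ) : SimpleGraph (Σ i : Fin k, Fin (s i + 1)) where
  Adj x y := x.1 = y.1 ∧
    (((x.2 : ℕ) = 0 ∧ (y.2 : ℕ) ≠ 0) ∨ ((x.2 : ℕ) ≠ 0 ∧ (y.2 : ℕ) = 0))
  symm.symm := by
    rintro x y ⟨h, h'⟩
    exact ⟨h.symm, by tauto⟩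
  loopless := ⟨by
    rintro x ⟨-, h⟩
    tauto⟩

/-- A proper edge-colouring of `G` is a proper vertex colouring of its line graph. -/
abbrev ProperEdgeColoring {V : Type*} (G : SimpleGraph V) (α : Type*) := G.lineGraph.Coloring α

/-- The copy `f` of `F` in the edge-coloured graph `G` is rainbow: its edges have pairwise distinct
colours. -/
def IsRainbow {W V α : Type*} {F : SimpleGraph W} {G : SimpleGraph V}
    (χ : ProperEdgeColoring G α) (f : Copy F G) : Prop :=
  Function.Injective fun e : F.edgeSet => χ (f.mapEdgeSet e)

/-- `G` has a proper edge-colouring (as graphs are finite here, colours may be taken in `ℕ`)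
without a rainbow copy of `F`. -/
def HasRainbowFreeColoring {W V : Type*} (F : SimpleGraph W) (G : SimpleGraph V) : Prop :=
  ∃ χ : ProperEdgeColoring G ℕ, ∀ f : Copy F G, ¬ IsRainbow χ f

open Classical in
/-- `G` has the maximum number of edges among all graphs on its vertex set that have a proper
edge-colouring without a rainbow copy of `F`. -/
def IsRainbowExtremal {W V : Type*} [Fintype V] (F : SimpleGraph W) (G : SimpleGraph V) : Prop :=
  G.IsExtremal (HasRainbowFreeColoring F)

/-- `f(c) = e(S_1) + ⋯ + e(S_{k-c}) - 1`. -/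
def fval {k : ℕ} (s : Fin k → ℕ) (c : ℕ) : ℕ :=
  (∑ i ∈ Finset.univ.filter (fun i : Fin k => i.val < k - c), s i) - 1

open Classical in
/-- The graph `H` that is joined to the `c` universal vertices: for `c = k - 1` it has the maximum
number of edges among the graphs of maximum degree at most `f(c)`, and otherwise among the graphs
that are `f(c)`-edge-colourable. -/
def IsCore {k m : ℕ} (s : Fin k → ℕ) (c : ℕ) (H : SimpleGraph (Fin m)) : Prop :=
  if c + 1 = k then H.IsExtremal (fun K => ∀ v, K.degree v ≤ fval s c)
  else H.IsExtremal (fun K => K.lineGraph.Colorable (fval s c))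

/-- `c` universal vertices joined to `H`. -/
def addUniversal {m : ℕ} (c : ℕ) (H : SimpleGraph (Fin m)) : SimpleGraph (Fin c ⊕ Fin m) :=
  ((⊤ : SimpleGraph (Fin c)) ⊕g H) ⊔ completeBipartiteGraph (Fin c) (Fin m)

/-- `G` is isomorphic to (one of the graphs) `H_F(n,c)`. -/
def IsHGraph {k n : ℕ} (s : Fin k → ℕ) (c : ℕ) (G : SimpleGraph (Fin n)) : Prop :=
  ∃ H : SimpleGraph (Fin (n - c)), IsCore s c H ∧ Nonempty (G ≃g addUniversal c H)

end RainbowStars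

/-!
Write `f(c)` for the sum of the `k - c` smallest star sizes minus one. The proof bounds the number
of edges of an arbitrary graph `G` with a rainbow-free colouring by that of some `H_F(n, c)`, and
then compares the graphs `H_F(n, c)` with each other.

*Upper bound.* Let `U` be the set of vertices of `G` whose degree exceeds a large constant. Stars
can be added greedily at such vertices, whatever has been chosen before
(`HasRainbowStars.extend_of_le_degree`). Hence `c = #U < k`, and the graph `H` on the other vertices
has bounded degree and no rainbow copy of the forest of the `k - c` smallest stars. If `c = k - 1`,
this says that `H` has maximum degree at most `f(k - 1)`. If `c ≤ k - 2`, then either `H` has fewer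
than `f(c) ⌊(n - c) / 2⌋` edges or `H` is edge-colourable with `f(c)` colours
(`colorable_or_ncard_edgeSet_lt`). Indeed, if `H` has that many edges, then linearly many of its
vertices have degree at least `f(c)`, and many of them are far apart, so that stars at them can
conflict only by their colours. Counting the spoilt edges at such vertices
(`HasRainbowStars.extend_of_degree_le`) shows that every colour at a vertex that can be the centre
of the smallest star occurs at almost all of them (`card_color_ne_le`), so that there are at most
`f(c)` such colours; an edge of another colour joins two vertices of degree less than the smallest
star size, and this loses too many edges. In each case `G` has at most as many edges as
`H_F(n, c)`, and it is an `H_F(n, c)` in the case of equality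
(`HasRainbowFreeColoring.exists_addUniversal`).

*Lower bound.* The graphs `H_F(n, c)` have rainbow-free colourings: use `f(c)` colours on `H` and
pairwise different new colours on the edges at the universal vertices. At least `k - c` stars of a
copy of the forest lie in `H` (`hasRainbowFreeColoring_addUniversal`). So the extremal graphs are
the `H_F(n, c)` for those `c` that maximize the number of edges (`isRainbowExtremal_iff`).

*Comparison.* Disjoint near-perfect matchings show that the number of edges of `H_F(n, c)` is
`(2 c + f(c)) n / 2` up to a bounded error, and `2 c + f(c)` is convex in `c` because the star sizes
are sorted. Hence an inner `c` can compete with the ends only if `2 c + f(c)` is constant, that is,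
if all stars but the smallest have two edges; then the bounded terms decide.
-/

namespace RainbowStars

open SimpleGraph Finset
open scoped Classical

variable {V ι : Type*}

/-! ### Rainbow families of stars -/

/-- The colours `col` give distinct colours to any two edges of `G` with a common end. The values
of `col` off the edge set are irrelevant. -/
def ProperOn (G : SimpleGraph V) (col : Sym2 V → ℕ) : Prop :=
  ∀ ⦃u v w⦄, G.Adj u v → G.Adj u w → col s(u, v) = col s(u, w) → v = w

/-- The stars with centre `x i` and set of leaves `L i`, for `i ∈ I`, are vertex-disjoint stars of
`G` with `s i` edges, and no colour occurs in two of them. (Within one star the colours differ as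
soon as the colouring is proper.) -/
structure RainbowFamily (G : SimpleGraph V) (col : Sym2 V → ℕ) (s : ι → ℕ) (I : Finset ι)
    (x : ι → V) (L : ι → Finset V) : Prop where
  card_leaves : ∀ i ∈ I, #(L i) = s i
  adj : ∀ i ∈ I, ∀ w ∈ L i, G.Adj (x i) w
  center_inj : ∀ i ∈ I, ∀ j ∈ I, x i = x j → i = j
  center_notMem : ∀ i ∈ I, ∀ j ∈ I, x i ∉ L j
  leaf_inj : ∀ i ∈ I, ∀ j ∈ I, ∀ w, w ∈ L i → w ∈ L j → i = j
  color_inj : ∀ i ∈ I, ∀ j ∈ I, ∀ w ∈ L i, ∀ w' ∈ L j,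
    col s(x i, w) = col s(x j, w') → i = j

lemma RainbowFamily.mono {G : SimpleGraph V} {col : Sym2 V → ℕ} {s : ι → ℕ} {I J : Finset ι}
    {x : ι → V} {L : ι → Finset V} (h : RainbowFamily G col s J x L) (hIJ : I ⊆ J) :
    RainbowFamily G col s I x L where
  card_leaves i hi := h.card_leaves i (hIJ hi)
  adj i hi := h.adj i (hIJ hi)
  center_inj i hi j hj := h.center_inj i (hIJ hi) j (hIJ hj)
  center_notMem i hi j hj := h.center_notMem i (hIJ hi) j (hIJ hj)
  leaf_inj i hi j hj := h.leaf_inj i (hIJ hi) j (hIJ hj)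
  color_inj i hi j hj := h.color_inj i (hIJ hi) j (hIJ hj)

lemma exists_of_mem_edgeSet_starForest {k : ℕ} {s : Fin k → ℕ}
    {e : Sym2 (Σ i : Fin k, Fin (s i + 1))} (he : e ∈ (starForest s).edgeSet) :
    ∃ (i : Fin k) (j : Fin (s i)), e = s(⟨i, 0⟩, ⟨i, j.succ⟩) := by
  induction e with | _ a b
  obtain ⟨i, a⟩ := a
  obtain ⟨j, b⟩ := b
  obtain ⟨h1, h2⟩ := he
  obtain rfl : i = j := h1
  induction a using Fin.cases with
  | zero =>
    induction b using Fin.cases with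
    | zero => simp at h2
    | succ b => exact ⟨i, b, rfl⟩
  | succ a =>
    induction b using Fin.cases with
    | zero => exact ⟨i, a, Sym2.eq_swap⟩
    | succ b => simp at h2

lemma starForest_adj_zero_succ {k : ℕ} (s : Fin k → ℕ) (i : Fin k) (j : Fin (s i)) :
    (starForest s).Adj ⟨i, 0⟩ ⟨i, j.succ⟩ :=
  ⟨rfl, by simp⟩

lemma exists_isRainbow_iff {k : ℕ} {s : Fin k → ℕ} {G : SimpleGraph V}
    (χ : ProperEdgeColoring G ℕ) {col : Sym2 V → ℕ} (hχ : ∀ e : G.edgeSet, χ e = col e)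
    (hc : ProperOn G col) :
    (∃ f : Copy (starForest s) G, IsRainbow χ f) ↔ ∃ x L, RainbowFamily G col s univ x L := by
  constructor
  · rintro ⟨f, hf⟩
    have finj : ∀ {a b}, f a = f b → a = b := fun h => f.injective h
    have key : ∀ (i j : Fin k) (a : Fin (s i)) (b : Fin (s j)),
        col s(f ⟨i, 0⟩, f ⟨i, a.succ⟩) = col s(f ⟨j, 0⟩, f ⟨j, b.succ⟩) → i = j := by
      intro i j a b h
      let E (i : Fin k) (a : Fin (s i)) : (starForest s).edgeSet :=
        ⟨s(⟨i, 0⟩, ⟨i, a.succ⟩), starForest_adj_zero_succ s i a⟩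
      have := hf (((hχ (f.mapEdgeSet (E i a))).trans h).trans (hχ (f.mapEdgeSet (E j b))).symm)
      rcases Sym2.eq_iff.1 (congrArg Subtype.val this) with h | h <;>
        exact congrArg Sigma.fst h.1
    refine ⟨fun i => f ⟨i, 0⟩, fun i => univ.image fun j : Fin (s i) => f ⟨i, j.succ⟩,
      ?_, ?_, ?_, ?_, ?_, ?_⟩
    · intro i _
      rw [card_image_of_injective, card_univ, Fintype.card_fin]
      intro a b h
      simpa using finj h
    · intro i _ w hw
      obtain ⟨j, -, rfl⟩ := mem_image.1 hw
      exact f.toHom.map_adj (starForest_adj_zero_succ s i j)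
    · intro i _ j _ h
      exact congrArg Sigma.fst (finj h)
    · intro i _ j _ h
      obtain ⟨a, -, h⟩ := mem_image.1 h
      obtain ⟨rfl, h⟩ := Sigma.mk.inj (finj h)
      simp at h
    · intro i _ j _ w hi hj
      obtain ⟨a, -, rfl⟩ := mem_image.1 hi
      obtain ⟨b, -, h⟩ := mem_image.1 hj
      exact (congrArg Sigma.fst (finj h)).symm
    · intro i _ j _ w hi w' hj h
      obtain ⟨a, -, rfl⟩ := mem_image.1 hi
      obtain ⟨b, -, rfl⟩ := mem_image.1 hj
      exact key i j a b h
  · rintro ⟨x, L, h⟩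
    have e : ∀ i, Fin (s i) ≃ L i := fun i =>
      (Finset.equivFinOfCardEq (h.card_leaves i (mem_univ i))).symm
    let g : (Σ i : Fin k, Fin (s i + 1)) → V := fun p =>
      Fin.cases (x p.1) (fun j => (e p.1 j : V)) p.2
    have g0 : ∀ i, g ⟨i, 0⟩ = x i := fun i => rfl
    have g1 : ∀ i j, g ⟨i, Fin.succ j⟩ = e i j := fun i j => rfl
    have gadj : ∀ i j, G.Adj (x i) (e i j) := fun i j => h.adj i (mem_univ i) _ (e i j).2
    have ginj : Function.Injective g := by
      rintro ⟨i, a⟩ ⟨j, b⟩ hab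
      induction a using Fin.cases with
      | zero =>
        induction b using Fin.cases with
        | zero =>
          obtain rfl := h.center_inj i (mem_univ i) j (mem_univ j) hab
          rfl
        | succ b =>
          exact (h.center_notMem i (mem_univ i) j (mem_univ j)
            (by rw [← g0, hab, g1]; exact (e j b).2)).elim
      | succ a =>
        induction b using Fin.cases with
        | zero =>
          exact (h.center_notMem j (mem_univ j) i (mem_univ i)
            (by rw [← g0, ← hab, g1]; exact (e i a).2)).elim
        | succ b =>
          obtain rfl := h.leaf_inj i (mem_univ i) j (mem_univ j) _ (e i a).2
            (by rw [← g1, hab, g1]; exact (e j b).2)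
          have hab' : a = b := (e i).injective (Subtype.ext hab)
          rw [hab']
    let f : Copy (starForest s) G := ⟨⟨g, by
      intro a b hab
      obtain ⟨i, j, hj⟩ := exists_of_mem_edgeSet_starForest (e := s(a, b)) hab
      rcases Sym2.eq_iff.1 hj with ⟨rfl, rfl⟩ | ⟨rfl, rfl⟩
      · exact gadj i j
      · exact (gadj i j).symm⟩, ginj⟩
    refine ⟨f, ?_⟩
    rintro ⟨e₁, h₁⟩ ⟨e₂, h₂⟩ h12
    obtain ⟨i, a, rfl⟩ := exists_of_mem_edgeSet_starForest h₁
    obtain ⟨j, b, rfl⟩ := exists_of_mem_edgeSet_starForest h₂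
    have h12 : col s(x i, e i a) = col s(x j, e j b) :=
      (hχ _).symm.trans (h12.trans (hχ _))
    obtain rfl := h.color_inj i (mem_univ i) j (mem_univ j) _ (e i a).2 _ (e j b).2 h12
    obtain rfl := (e i).injective (Subtype.ext (hc (gadj i a) (gadj i b) h12))
    rfl

lemma hasRainbowFreeColoring_iff {k : ℕ} {s : Fin k → ℕ} {G : SimpleGraph V} :
    HasRainbowFreeColoring (starForest s) G ↔
      ∃ col, ProperOn G col ∧ ∀ x L, ¬ RainbowFamily G col s univ x L := by
  constructor
  · rintro ⟨χ, h⟩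
    let col : Sym2 V → ℕ := fun e => if he : e ∈ G.edgeSet then χ ⟨e, he⟩ else 0
    have hχ : ∀ e : G.edgeSet, χ e = col e := fun e => by simp [col]
    have hcol : ProperOn G col := by
      intro u v w hv hw huvw
      by_contra hne
      refine χ.valid (v := ⟨s(u, v), hv⟩) (w := ⟨s(u, w), hw⟩) ⟨?_, u, ?_⟩ ?_
      · exact fun h => hne (Sym2.congr_right.1 (congrArg Subtype.val h))
      · simp
      · rw [hχ, hχ]
        exact huvw
    refine ⟨col, hcol, fun x L hF => ?_⟩
    obtain ⟨f, hf⟩ := (exists_isRainbow_iff χ hχ hcol).2 ⟨x, L, hF⟩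
    exact h f hf
  · rintro ⟨col, hcol, h⟩
    let χ : ProperEdgeColoring G ℕ := Coloring.mk (fun e => col e) (by
      rintro ⟨e₁, h₁⟩ ⟨e₂, h₂⟩ ⟨hne, u, hu₁, hu₂⟩ heq
      obtain ⟨v, rfl⟩ := Sym2.mem_iff_exists.1 hu₁
      obtain ⟨w, rfl⟩ := Sym2.mem_iff_exists.1 hu₂
      obtain rfl := hcol h₁ h₂ heq
      exact hne rfl)
    refine ⟨χ, fun f hf => ?_⟩
    obtain ⟨x, L, hF⟩ := (exists_isRainbow_iff χ (fun _ => rfl) hcol).1 ⟨f, hf⟩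
    exact h x L hF

lemma exists_properOn_of_colorable {G : SimpleGraph V} {r : ℕ} (h : G.lineGraph.Colorable r) :
    ∃ col, ProperOn G col ∧ ∀ e ∈ G.edgeSet, col e < r := by
  obtain ⟨χ⟩ := h
  refine ⟨fun e => if he : e ∈ G.edgeSet then χ ⟨e, he⟩ else 0, ?_, ?_⟩
  · intro u v w hv hw huvw
    by_contra hne
    refine χ.valid (v := ⟨s(u, v), hv⟩) (w := ⟨s(u, w), hw⟩) ⟨?_, u, ?_⟩ ?_
    · exact fun h => hne (Sym2.congr_right.1 (congrArg Subtype.val h))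
    · simp
    · simpa [hv, hw, Fin.ext_iff] using huvw
  · intro e he
    simp [he]

lemma ProperOn.colorable {G : SimpleGraph V} {col : Sym2 V → ℕ} (hcol : ProperOn G col)
    {C : Finset ℕ} (hC : ∀ e ∈ G.edgeSet, col e ∈ C) : G.lineGraph.Colorable #C := by
  have χ : G.lineGraph.Coloring C := Coloring.mk (fun e => ⟨col e, hC e e.2⟩) (by
    rintro ⟨e₁, h₁⟩ ⟨e₂, h₂⟩ ⟨hne, u, hu₁, hu₂⟩ heq
    obtain ⟨v, rfl⟩ := Sym2.mem_iff_exists.1 hu₁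
    obtain ⟨w, rfl⟩ := Sym2.mem_iff_exists.1 hu₂
    obtain rfl := hcol h₁ h₂ (congrArg Subtype.val heq)
    exact hne rfl)
  simpa using χ.colorable

/-! ### Building rainbow stars greedily -/

/-- `HasRainbowStars G col s I W C`: starting from nothing, vertex-disjoint stars with `s i` edges,
one for each `i ∈ I`, have been added to `G` one after the other, each avoiding the vertices and
colours of the earlier ones; they cover the vertices `W` and use the colours `C`. -/
inductive HasRainbowStars (G : SimpleGraph V) (col : Sym2 V → ℕ) (s : ι → ℕ) :
    Finset ι → Finset V → Finset ℕ → Prop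
  | nil : HasRainbowStars G col s ∅ ∅ ∅
  | cons {I : Finset ι} {W : Finset V} {C : Finset ℕ} (i : ι) (v : V) (B : Finset V) :
      HasRainbowStars G col s I W C → i ∉ I → v ∉ W → (∀ w ∈ B, G.Adj v w) → #B = s i →
      (∀ w ∈ B, w ∉ W) → (∀ w ∈ B, col s(v, w) ∉ C) →
      HasRainbowStars G col s (insert i I) (insert v (B ∪ W)) (B.image (fun w => col s(v, w)) ∪ C)

namespace HasRainbowStars

variable {G : SimpleGraph V} {col : Sym2 V → ℕ} {s : ι → ℕ} {I : Finset ι} {W : Finset V}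
  {C : Finset ℕ}

lemma card_verts_le (h : HasRainbowStars G col s I W C) : #W ≤ ∑ i ∈ I, (s i + 1) := by
  induction h with
  | nil => simp
  | @cons I W C i v B _ hi _ _ hB _ _ ih =>
    rw [sum_insert hi]
    have h1 := card_insert_le v (B ∪ W)
    have h2 := card_union_le B W
    omega

lemma card_colors_le (h : HasRainbowStars G col s I W C) : #C ≤ ∑ i ∈ I, s i := by
  induction h with
  | nil => simp
  | @cons I W C i v B _ hi _ _ hB _ _ ih =>
    rw [sum_insert hi]
    have h1 := card_union_le (B.image fun w => col s(v, w)) C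
    have h2 : #(B.image fun w => col s(v, w)) ≤ #B := card_image_le
    omega

lemma exists_family [Nonempty V] (h : HasRainbowStars G col s I W C) :
    ∃ x L, RainbowFamily G col s I x L ∧
      ∀ i ∈ I, x i ∈ W ∧ ∀ w ∈ L i, w ∈ W ∧ col s(x i, w) ∈ C := by
  induction h with
  | nil =>
    exact ⟨fun _ => Classical.arbitrary V, fun _ => ∅, by constructor <;> simp, by simp⟩
  | @cons I W C i v B _ hi hv hadj hB hBW hBC ih =>
    obtain ⟨x, L, hF, hWC⟩ := ih
    have hne : ∀ {j}, j ∈ I → j ≠ i := fun hj h => hi (h ▸ hj)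
    have x0 : Function.update x i v i = v := by simp
    have L0 : Function.update L i B i = B := by simp
    have x1 : ∀ j ∈ I, Function.update x i v j = x j := fun j hj => by simp [hne hj]
    have L1 : ∀ j ∈ I, Function.update L i B j = L j := fun j hj => by simp [hne hj]
    refine ⟨Function.update x i v, Function.update L i B, ⟨?_, ?_, ?_, ?_, ?_, ?_⟩, ?_⟩
    · intro j hj
      rcases mem_insert.1 hj with rfl | hj
      · rw [L0, hB]
      · rw [L1 j hj, hF.card_leaves j hj]
    · intro j hj
      rcases mem_insert.1 hj with rfl | hj
      · rwa [L0, x0]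
      · rw [L1 j hj, x1 j hj]
        exact hF.adj j hj
    · intro j hj l hl
      rw [mem_insert] at hj hl
      rcases hj with rfl | hj <;> rcases hl with rfl | hl
      · simp
      · rw [x0, x1 l hl]
        rintro rfl
        exact (hv (hWC l hl).1).elim
      · rw [x0, x1 j hj]
        rintro rfl
        exact (hv (hWC j hj).1).elim
      · rw [x1 j hj, x1 l hl]
        exact hF.center_inj j hj l hl
    · intro j hj l hl
      rw [mem_insert] at hj hl
      rcases hj with rfl | hj <;> rcases hl with rfl | hl
      · rw [x0, L0]
        exact fun h => (hadj _ h).ne rfl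
      · rw [x0, L1 l hl]
        exact fun h => hv ((hWC l hl).2 _ h).1
      · rw [L0, x1 j hj]
        exact fun h => hBW _ h (hWC j hj).1
      · rw [x1 j hj, L1 l hl]
        exact hF.center_notMem j hj l hl
    · intro j hj l hl w
      rw [mem_insert] at hj hl
      rcases hj with rfl | hj <;> rcases hl with rfl | hl
      · simp
      · rw [L0, L1 l hl]
        exact fun h h' => (hBW _ h ((hWC l hl).2 _ h').1).elim
      · rw [L0, L1 j hj]
        exact fun h' h => (hBW _ h ((hWC j hj).2 _ h').1).elim
      · rw [L1 j hj, L1 l hl]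
        exact hF.leaf_inj j hj l hl w
    · intro j hj l hl
      rw [mem_insert] at hj hl
      rcases hj with rfl | hj <;> rcases hl with rfl | hl
      · simp
      · rw [L0, L1 l hl, x0, x1 l hl]
        exact fun w h w' h' e => (hBC _ h (e ▸ ((hWC l hl).2 _ h').2)).elim
      · rw [L0, L1 j hj, x0, x1 j hj]
        exact fun w h w' h' e => (hBC _ h' (e ▸ ((hWC j hj).2 _ h).2)).elim
      · rw [L1 j hj, L1 l hl, x1 j hj, x1 l hl]
        exact hF.color_inj j hj l hl
    · intro j hj
      rcases mem_insert.1 hj with rfl | hj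
      · rw [x0, L0]
        refine ⟨mem_insert_self _ _, fun w hw => ⟨?_, ?_⟩⟩
        · exact mem_insert_of_mem (mem_union_left _ hw)
        · exact mem_union_left _ (mem_image_of_mem _ hw)
      · rw [x1 j hj, L1 j hj]
        refine ⟨mem_insert_of_mem (mem_union_right _ (hWC j hj).1), fun w hw => ⟨?_, ?_⟩⟩
        · exact mem_insert_of_mem (mem_union_right _ ((hWC j hj).2 w hw).1)
        · exact mem_union_right _ ((hWC j hj).2 w hw).2

lemma map {V' : Type*} (φ : V' ↪ V) {W : Finset V'}
    (h : HasRainbowStars (G.comap φ) (fun e => col (e.map φ)) s I W C) :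
    HasRainbowStars G col s I (W.map φ) C := by
  induction h with
  | nil => simpa using HasRainbowStars.nil
  | @cons I W C i v B _ hi hv hadj hB hBW hBC ih =>
    have := HasRainbowStars.cons i (φ v) (B.map φ) ih hi (by simpa using hv)
      (by simpa using hadj) (by simpa using hB) (by simpa using hBW) (by simpa using hBC)
    convert! this using 1
    · rw [map_insert, map_union]
    · rw [map_eq_image, image_image]
      rfl

/-- A star with centre `v` can be added as soon as enough neighbours of `v` are unspoilt, where a
further set `Z` of vertices may be kept free. -/
lemma exists_insert [Fintype V] (h : HasRainbowStars G col s I W C) {i : ι} (hi : i ∉ I) {v : V}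
    (hv : v ∉ W) (Z : Finset V)
    (hcard : s i ≤ #{w ∈ G.neighborFinset v | (w ∉ W ∧ w ∉ Z) ∧ col s(v, w) ∉ C}) :
    ∃ B : Finset V, #B = s i ∧ (∀ w ∈ B, w ∉ Z) ∧
      HasRainbowStars G col s (insert i I) (insert v (B ∪ W))
        (B.image (fun w => col s(v, w)) ∪ C) := by
  obtain ⟨B, hB, hBc⟩ := exists_subset_card_eq hcard
  have hB' : ∀ w ∈ B, G.Adj v w ∧ (w ∉ W ∧ w ∉ Z) ∧ col s(v, w) ∉ C := fun w hw => by
    simpa using hB hw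
  exact ⟨B, hBc, fun w hw => (hB' w hw).2.1.2, .cons i v B h hi hv (fun w hw => (hB' w hw).1) hBc
    (fun w hw => (hB' w hw).2.1.1) fun w hw => (hB' w hw).2.2⟩

end HasRainbowStars

section greedy

variable [Fintype V] {G : SimpleGraph V} {col : Sym2 V → ℕ} {s : ι → ℕ}

lemma ProperOn.card_filter_le (hcol : ProperOn G col) (v : V) (C : Finset ℕ) :
    #{w ∈ G.neighborFinset v | col s(v, w) ∈ C} ≤ #C := by
  refine card_le_card_of_injOn (fun w => col s(v, w)) (fun w hw => ?_) fun w hw w' hw' h => ?_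
  · exact (mem_filter.1 hw).2
  · have h1 := (mem_filter.1 hw).1
    have h2 := (mem_filter.1 hw').1
    rw [mem_neighborFinset] at h1 h2
    exact hcol h1 h2 h

/-- Vertices of large degree can serve as the centres of all the stars that are still missing. -/
lemma HasRainbowStars.extend_of_le_degree [Fintype ι] (hcol : ProperOn G col) {U : Finset V}
    {I : Finset ι} {W : Finset V} {C : Finset ℕ} (h : HasRainbowStars G col s I W C)
    (hU : #U = #Iᶜ) (hUW : ∀ u ∈ U, u ∉ W)
    (hdeg : ∀ u ∈ U, 3 * ∑ i, s i + 2 * Fintype.card ι ≤ G.degree u) :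
    ∃ W C, HasRainbowStars G col s univ W C := by
  induction hn : #U generalizing U I W C with
  | zero =>
    obtain rfl : I = univ := by
      rw [← compl_eq_empty_iff, ← card_eq_zero]
      omega
    exact ⟨W, C, h⟩
  | succ n ih =>
    obtain ⟨u, hu⟩ : U.Nonempty := card_pos.1 (by omega)
    obtain ⟨i, hi⟩ : Iᶜ.Nonempty := card_pos.1 (by omega)
    have hi' : i ∉ I := mem_compl.1 hi
    have h1 : #W ≤ ∑ i, s i + Fintype.card ι := by
      refine h.card_verts_le.trans ?_
      refine (sum_le_sum_of_subset (subset_univ I)).trans ?_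
      simp [sum_add_distrib]
    have h2 : #C ≤ ∑ i, s i := h.card_colors_le.trans (sum_le_sum_of_subset (subset_univ I))
    have h3 : s i ≤ ∑ i, s i := single_le_sum (fun _ _ => Nat.zero_le _) (mem_univ i)
    have h4 : #U ≤ Fintype.card ι := hU ▸ card_le_univ _
    have h5 := hdeg u hu
    have h6 := hcol.card_filter_le u C
    have h7 : G.neighborFinset u ⊆ W ∪ (U ∪ ({w ∈ G.neighborFinset u | col s(u, w) ∈ C} ∪
        {w ∈ G.neighborFinset u | (w ∉ W ∧ w ∉ U) ∧ col s(u, w) ∉ C})) := by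
      intro w hw
      simp only [mem_union, mem_filter, hw, true_and]
      tauto
    have h8 := card_le_card h7
    have h9 := card_union_le W (U ∪ ({w ∈ G.neighborFinset u | col s(u, w) ∈ C} ∪
        {w ∈ G.neighborFinset u | (w ∉ W ∧ w ∉ U) ∧ col s(u, w) ∉ C}))
    have h10 := card_union_le U ({w ∈ G.neighborFinset u | col s(u, w) ∈ C} ∪
        {w ∈ G.neighborFinset u | (w ∉ W ∧ w ∉ U) ∧ col s(u, w) ∉ C})
    have h11 := card_union_le ({w ∈ G.neighborFinset u | col s(u, w) ∈ C})
        {w ∈ G.neighborFinset u | (w ∉ W ∧ w ∉ U) ∧ col s(u, w) ∉ C}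
    rw [card_neighborFinset_eq_degree] at h8
    obtain ⟨B, -, hBU, hB⟩ := h.exists_insert hi' (hUW u hu) U (by omega)
    refine ih (U := U.erase u) hB ?_ ?_ (fun w hw => hdeg w (mem_of_mem_erase hw)) ?_
    · rw [card_erase_of_mem hu, hU, compl_insert, card_erase_of_mem hi]
    · intro w hw
      obtain ⟨hwu, hw⟩ := mem_erase.1 hw
      simp only [mem_insert, mem_union, not_or]
      exact ⟨hwu, fun h => hBU w h hw, hUW w hw⟩
    · rw [card_erase_of_mem hu]
      omega

/-- In a graph of bounded degree the missing stars can be added at vertices of a large set `A`: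
vertices of `A` away from the stars chosen so far exist throughout, and adding a star with `s i`
edges spoils at most `s i` of the edges at any other vertex, so that the hypothesis on the degrees
in `A` is preserved. -/
lemma HasRainbowStars.extend_of_degree_le (hcol : ProperOn G col) {M : ℕ}
    (hM : ∀ v, G.degree v ≤ M) {A : Finset V} {I J : Finset ι} {W : Finset V} {C : Finset ℕ}
    (h : HasRainbowStars G col s I W C) (hIJ : I ⊆ J)
    (hA : ∀ v ∈ A, #{w ∈ G.neighborFinset v | col s(v, w) ∈ C} + ∑ i ∈ J \ I, s i ≤ G.degree v)
    (hcard : (∑ i ∈ J, (s i + 1)) * (M + 1) < #A) :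
    ∃ W C, HasRainbowStars G col s J W C := by
  induction hn : #(J \ I) generalizing I W C with
  | zero =>
    obtain rfl : I = J := subset_antisymm hIJ (sdiff_eq_empty_iff_subset.1 (card_eq_zero.1 hn))
    exact ⟨W, C, h⟩
  | succ n ih =>
    obtain ⟨i, hi⟩ : (J \ I).Nonempty := card_pos.1 (by omega)
    obtain ⟨hiJ, hiI⟩ := mem_sdiff.1 hi
    obtain ⟨v, hvA, hv⟩ : ∃ v ∈ A, v ∉ W ∪ W.biUnion (fun u => G.neighborFinset u) := by
      by_contra! hcon
      have h1 : #A ≤ #(W ∪ W.biUnion fun u => G.neighborFinset u) := card_le_card hcon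
      have h2 := card_union_le W (W.biUnion fun u => G.neighborFinset u)
      have h3 : #(W.biUnion fun u => G.neighborFinset u) ≤ #W * M :=
        card_biUnion_le_card_mul _ _ _ fun v _ => (card_neighborFinset_eq_degree G v).trans_le (hM v)
      have h4 : #W ≤ ∑ i ∈ J, (s i + 1) := h.card_verts_le.trans (sum_le_sum_of_subset hIJ)
      have h5 := Nat.mul_le_mul_right (M + 1) h4
      rw [mul_add_one] at h5
      omega
    simp only [mem_union, mem_biUnion, mem_neighborFinset, not_or, not_exists, not_and] at hv
    have hsum : ∑ j ∈ J \ I, s j = s i + ∑ j ∈ J \ insert i I, s j := by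
      rw [sdiff_insert, add_sum_erase _ _ hi]
    obtain ⟨B, hBc, -, hB⟩ := h.exists_insert hiI hv.1 ∅ (by
      have h1 := hA v hvA
      rw [← card_neighborFinset_eq_degree, ← card_filter_add_card_filter_not
        (s := G.neighborFinset v) (fun w => col s(v, w) ∈ C)] at h1
      have h2 : #{w ∈ G.neighborFinset v | ¬ col s(v, w) ∈ C} ≤
          #{w ∈ G.neighborFinset v | (w ∉ W ∧ w ∉ (∅ : Finset V)) ∧ col s(v, w) ∉ C} := by
        refine card_le_card fun w hw => ?_
        simp only [mem_filter, mem_neighborFinset] at hw ⊢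
        exact ⟨hw.1, ⟨fun h => hv.2 w h hw.1.symm, notMem_empty w⟩, hw.2⟩
      omega)
    refine ih hB (insert_subset hiJ hIJ) (fun v' hv' => ?_) ?_
    · have h1 := hA v' hv'
      have h2 := hcol.card_filter_le v' (B.image fun w => col s(v, w))
      have h3 : #(B.image fun w => col s(v, w)) ≤ #B := card_image_le
      have h4 : ({w ∈ G.neighborFinset v' | col s(v', w) ∈ B.image (fun w => col s(v, w)) ∪ C}) =
          {w ∈ G.neighborFinset v' | col s(v', w) ∈ B.image (fun w => col s(v, w))} ∪
          {w ∈ G.neighborFinset v' | col s(v', w) ∈ C} := by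
        ext w
        simp only [mem_filter, mem_union]
        tauto
      rw [h4]
      have h5 := card_union_le {w ∈ G.neighborFinset v' | col s(v', w) ∈ B.image fun w => col s(v, w)}
        {w ∈ G.neighborFinset v' | col s(v', w) ∈ C}
      omega
    · rw [sdiff_insert, card_erase_of_mem hi]
      omega

end greedy

/-! ### Graphs of bounded degree without rainbow stars -/

section bounded

lemma two_mul_ncard_edgeSet [Fintype V] (G : SimpleGraph V) :
    2 * G.edgeSet.ncard = ∑ v, G.degree v := by
  rw [sum_degrees_eq_twice_card_edges, ← coe_edgeFinset, Set.ncard_coe_finset]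

variable [Fintype V] {G : SimpleGraph V} {col : Sym2 V → ℕ} {s : ι → ℕ} {M : ℕ} {J : Finset ι}

lemma card_sum_le_degree_le (hcol : ProperOn G col) (hM : ∀ v, G.degree v ≤ M)
    (hno : ¬ ∃ W C, HasRainbowStars G col s J W C) :
    #{v | ∑ i ∈ J, s i ≤ G.degree v} ≤ (∑ i ∈ J, (s i + 1)) * (M + 1) := by
  by_contra! h
  refine hno (HasRainbowStars.nil.extend_of_degree_le hcol hM (empty_subset J) (fun v hv => ?_) h)
  simpa using hv

/-- A colour at a vertex that can be the centre of the smallest star occurs at almost all vertices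
of degree at least `∑ i ∈ J, s i - 1`: otherwise a star using this colour, together with stars at
vertices which do not see this colour, would be a rainbow family. -/
lemma card_color_ne_le (hcol : ProperOn G col) (hM : ∀ v, G.degree v ≤ M)
    (hno : ¬ ∃ W C, HasRainbowStars G col s J W C) {i₀ : ι} (hi₀ : i₀ ∈ J) (hpos : 1 ≤ s i₀)
    {w z : V} (hwz : G.Adj w z) (hw : s i₀ ≤ G.degree w) :
    #{v | ∑ i ∈ J, s i ≤ G.degree v + 1 ∧ ∀ y, G.Adj v y → col s(v, y) ≠ col s(w, z)} ≤
      (∑ i ∈ J, (s i + 1)) * (M + 1) := by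
  by_contra! h
  obtain ⟨B, hzB, hBw, hB⟩ := exists_subsuperset_card_eq
    (singleton_subset_iff.2 ((mem_neighborFinset G w z).2 hwz)) (by simpa using hpos)
    (hw.trans_eq (card_neighborFinset_eq_degree G w).symm)
  have hstar : HasRainbowStars G col s (insert i₀ ∅) (insert w (B ∪ ∅))
      (B.image (fun y => col s(w, y)) ∪ ∅) :=
    .cons i₀ w B .nil (by simp) (by simp) (fun y hy => by simpa using hBw hy) hB (by simp) (by simp)
  refine hno (hstar.extend_of_degree_le hcol hM (by simpa using hi₀) (fun v hv => ?_) h)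
  simp only [mem_filter, mem_univ, true_and] at hv
  have hz : col s(w, z) ∈ B.image (fun y => col s(w, y)) :=
    mem_image_of_mem (fun y => col s(w, y)) (singleton_subset_iff.1 hzB)
  have h1 : #{y ∈ G.neighborFinset v | col s(v, y) ∈ B.image (fun y => col s(w, y)) ∪ ∅} ≤
      #{y ∈ G.neighborFinset v |
        col s(v, y) ∈ (B.image (fun y => col s(w, y))).erase (col s(w, z))} := by
    refine card_le_card fun y hy => ?_
    rw [union_empty, mem_filter] at hy
    exact mem_filter.2 ⟨hy.1, mem_erase.2 ⟨hv.2 y (by simpa using hy.1), hy.2⟩⟩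
  have h2 := hcol.card_filter_le v ((B.image (fun y => col s(w, y))).erase (col s(w, z)))
  rw [card_erase_of_mem hz] at h2
  have h3 : #(B.image fun y => col s(w, y)) ≤ #B := card_image_le
  have h4 : ∑ i ∈ J \ insert i₀ ∅, s i + s i₀ = ∑ i ∈ J, s i := by
    rw [insert_empty_eq, sdiff_singleton_eq_erase, sum_erase_add _ _ hi₀]
  omega

/-- A graph of bounded degree without the rainbow stars given by `J` either has fewer edges than
`∑ i ∈ J, s i - 1` disjoint maximum matchings, or it is edge-colourable with that number of
colours. The bound on the number of vertices leaves room for more than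
`(∑ i ∈ J, s i + 1) * K` vertices of degree at least `∑ i ∈ J, s i - 1`, where `K` is the bound of
`card_color_ne_le`. -/
theorem colorable_or_ncard_edgeSet_lt (hcol : ProperOn G col) (hM : ∀ v, G.degree v ≤ M)
    (hno : ¬ ∃ W C, HasRainbowStars G col s J W C) {i₀ : ι} (hi₀ : i₀ ∈ J) (hpos : 1 ≤ s i₀)
    (hmin : ∀ i ∈ J, s i₀ ≤ s i) (hJ : 2 ≤ #J)
    (hV : (∑ i ∈ J, s i + 1) * ((∑ i ∈ J, (s i + 1)) * (M + 1)) * M + ∑ i ∈ J, s i ≤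
      Fintype.card V) :
    G.lineGraph.Colorable (∑ i ∈ J, s i - 1) ∨
      G.edgeSet.ncard < (∑ i ∈ J, s i - 1) * (Fintype.card V / 2) := by
  rw [or_iff_not_imp_right, not_lt]
  intro hedges
  have hE2 : 2 * s i₀ ≤ ∑ i ∈ J, s i := by
    calc 2 * s i₀ ≤ #J * s i₀ := Nat.mul_le_mul_right _ hJ
      _ ≤ ∑ i ∈ J, s i := by simpa using card_nsmul_le_sum J s (s i₀) hmin
  have hX := @card_color_ne_le _ _ _ _ _ _ _ _ hcol hM hno i₀ hi₀ hpos
  have hY := card_sum_le_degree_le hcol hM hno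
  generalize (∑ i ∈ J, (s i + 1)) * (M + 1) = K at *
  generalize ∑ i ∈ J, s i = E at *
  have hdeg := two_mul_ncard_edgeSet G
  have hp : Fintype.card V ≤ 2 * (Fintype.card V / 2) + 1 := by omega
  generalize Fintype.card V / 2 = p at *
  -- By the number of edges, many vertices have degree at least `E - 1`.
  have hA : (E + 1) * K < #{v | E ≤ G.degree v + 1} := by
    by_contra! hA
    have h1 : ∑ v, G.degree v ≤ Fintype.card V * (E - 2) + #{v | E ≤ G.degree v + 1} * M := by
      calc ∑ v, G.degree v ≤ ∑ v, ((E - 2) + if E ≤ G.degree v + 1 then M else 0) := by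
            refine sum_le_sum fun v _ => ?_
            split_ifs with h
            · have := hM v
              omega
            · omega
        _ = _ := by
            rw [sum_add_distrib, ← sum_filter]
            simp
    have h2 := Nat.mul_le_mul_right M hA
    obtain ⟨E, rfl⟩ : ∃ E', E = E' + 2 := ⟨E - 2, by omega⟩
    simp only [Nat.add_sub_cancel, show E + 2 - 1 = E + 1 by omega] at *
    nlinarith
  -- The colours at vertices that can be the centre of the smallest star.
  set D : Finset ℕ := ({q : V × V | G.Adj q.1 q.2 ∧ s i₀ ≤ G.degree q.1} : Finset (V × V)).image
    (fun q => col s(q.1, q.2)) with hD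
  have hDmem : ∀ {w z}, G.Adj w z → s i₀ ≤ G.degree w → col s(w, z) ∈ D := fun {w z} h h' =>
    mem_image.2 ⟨(w, z), by simp [h, h'], rfl⟩
  -- Almost every vertex of degree at least `E - 1` sees any `E` of these colours, but then its
  -- degree is at least `E`, and there are only few such vertices.
  have hDcard : #D < E := by
    by_contra! hcon
    obtain ⟨D', hD', hD'c⟩ := exists_subset_card_eq hcon
    have hcover : ({v | E ≤ G.degree v + 1} : Finset V) ⊆ ({v | E ≤ G.degree v} : Finset V) ∪
        D'.biUnion fun d => {v | E ≤ G.degree v + 1 ∧ ∀ y, G.Adj v y → col s(v, y) ≠ d} := by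
      intro v hv
      simp only [mem_filter, mem_univ, true_and, mem_union, mem_biUnion] at hv ⊢
      by_contra! hv'
      obtain ⟨hv1, hv2⟩ := hv'
      refine absurd hv1 (not_lt.2 ?_)
      rw [← card_neighborFinset_eq_degree, ← hD'c]
      refine (card_le_card (t := (G.neighborFinset v).image fun y => col s(v, y)) ?_).trans
        card_image_le
      intro d hd
      obtain ⟨y, hy, rfl⟩ := hv2 d hd hv
      exact mem_image.2 ⟨y, by simpa using hy, rfl⟩
    have h1 := (card_le_card hcover).trans (card_union_le _ _)
    have h2 := card_biUnion_le_card_mul D'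
      (fun d => ({v | E ≤ G.degree v + 1 ∧ ∀ y, G.Adj v y → col s(v, y) ≠ d} : Finset V)) K
      (fun d hd => by
        obtain ⟨q, hq, rfl⟩ := mem_image.1 (hD' hd)
        simp only [mem_filter, mem_univ, true_and] at hq
        exact hX hq.1 hq.2)
    rw [hD'c] at h2
    rw [add_one_mul] at hA
    omega
  have hdegE : ∀ v, G.degree v ≤ E - 1 := by
    intro v
    by_contra! hcon
    have h1 : #((G.neighborFinset v).image fun y => col s(v, y)) = G.degree v := by
      rw [← card_neighborFinset_eq_degree]
      refine card_image_of_injOn fun y hy y' hy' h => ?_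
      rw [mem_coe, mem_neighborFinset] at hy hy'
      exact hcol hy hy' h
    have h2 : (G.neighborFinset v).image (fun y => col s(v, y)) ⊆ D := by
      intro d hd
      obtain ⟨y, hy, rfl⟩ := mem_image.1 hd
      exact hDmem (by simpa using hy) (by omega)
    have := card_le_card h2
    omega
  by_cases hall : ∀ e ∈ G.edgeSet, col e ∈ D
  · exact (hcol.colorable hall).mono (by omega)
  -- An edge with a further colour has two ends of degree less than `s i₀`, which costs too many
  -- edges.
  · exfalso
    push Not at hall
    obtain ⟨e, he, heD⟩ := hall
    induction e with | _ a b
    have hab : G.Adj a b := he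
    have ha : G.degree a < s i₀ := by
      by_contra! h
      exact heD (hDmem hab h)
    have hb : G.degree b < s i₀ := by
      by_contra! h
      exact heD (Sym2.eq_swap (a := a) ▸ hDmem hab.symm h)
    have h1 : ∑ v, G.degree v + 2 * (E - s i₀) ≤ Fintype.card V * (E - 1) := by
      calc ∑ v, G.degree v + 2 * (E - s i₀)
          = ∑ v, (G.degree v + if v ∈ ({a, b} : Finset V) then E - s i₀ else 0) := by
            rw [sum_add_distrib, sum_ite_mem, univ_inter, sum_const, card_pair hab.ne, smul_eq_mul]
        _ ≤ ∑ v : V, (E - 1) := by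
            refine sum_le_sum fun v _ => ?_
            split_ifs with h
            · rw [mem_insert, mem_singleton] at h
              rcases h with rfl | rfl <;> omega
            · exact hdegE v
        _ = _ := by simp
    have h2 : Fintype.card V * (E - 1) ≤ (2 * p + 1) * (E - 1) := Nat.mul_le_mul_right _ hp
    have h3 : (2 * p + 1) * (E - 1) = 2 * ((E - 1) * p) + (E - 1) := by ring
    omega

end bounded

/-! ### Adding universal vertices -/

section addUniversal

variable {m c : ℕ} (H : SimpleGraph (Fin m))

@[simp] lemma addUniversal_adj_inl_inl (a b : Fin c) :
    (addUniversal c H).Adj (.inl a) (.inl b) ↔ a ≠ b := by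
  simp [addUniversal]

@[simp] lemma addUniversal_adj_inl_inr (a : Fin c) (b : Fin m) :
    (addUniversal c H).Adj (.inl a) (.inr b) := by
  simp [addUniversal]

@[simp] lemma addUniversal_adj_inr_inl (a : Fin m) (b : Fin c) :
    (addUniversal c H).Adj (.inr a) (.inl b) := by
  simp [addUniversal]

@[simp] lemma addUniversal_adj_inr_inr (a b : Fin m) :
    (addUniversal c H).Adj (.inr a) (.inr b) ↔ H.Adj a b := by
  simp [addUniversal]

lemma two_mul_ncard_edgeSet_addUniversal :
    2 * (addUniversal c H).edgeSet.ncard = c * (c + m - 1) + m * c + 2 * H.edgeSet.ncard := by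
  have h1 : ∀ a : Fin c, (addUniversal c H).degree (.inl a) = c + m - 1 := by
    intro a
    have : (addUniversal c H).neighborFinset (.inl a) = univ.erase (.inl a) := by
      ext b
      rcases b with b | b <;> simp [eq_comm]
    rw [← card_neighborFinset_eq_degree, this, card_erase_of_mem (mem_univ _)]
    simp
  have h2 : ∀ b : Fin m, (addUniversal c H).degree (.inr b) = c + H.degree b := by
    intro b
    have : (addUniversal c H).neighborFinset (.inr b) = univ.disjSum (H.neighborFinset b) := by
      ext b
      rcases b with b | b <;> simp
    rw [← card_neighborFinset_eq_degree, this, card_disjSum]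
    simp
  rw [two_mul_ncard_edgeSet, Fintype.sum_sum_type, two_mul_ncard_edgeSet]
  simp only [h1, h2, sum_add_distrib]
  simp
  ring

end addUniversal

lemma ncard_edgeSet_eq_of_iso {W : Type*} {G : SimpleGraph V} {G' : SimpleGraph W}
    (f : G ≃g G') : G.edgeSet.ncard = G'.edgeSet.ncard :=
  Nat.card_congr f.mapEdgeSet

/-- Every graph arises from `c` universal vertices and the graph `H` on the other vertices by
deleting edges. -/
lemma exists_comap_addUniversal {n c : ℕ} (G : SimpleGraph (Fin n)) {U : Finset (Fin n)}
    (hU : #U = c) :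
    ∃ φ : Fin (n - c) ↪ Fin n, (∀ a, φ a ∉ U) ∧
      G.edgeSet.ncard ≤ (addUniversal c (G.comap φ)).edgeSet.ncard ∧
      ((addUniversal c (G.comap φ)).edgeSet.ncard ≤ G.edgeSet.ncard →
        Nonempty (G ≃g addUniversal c (G.comap φ))) := by
  have hU' : #Uᶜ = n - c := by rw [card_compl, Fintype.card_fin, hU]
  let e := finSumEquivOfFinset hU hU'
  let φ : Fin (n - c) ↪ Fin n := ⟨fun a => e (.inr a), fun a b h => Sum.inr_injective (e.injective h)⟩
  have hle : G.comap e ≤ addUniversal c (G.comap φ) := by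
    rintro (a | a) (b | b) hab
    · simpa using hab.ne
    · simp
    · simp
    · exact (addUniversal_adj_inr_inr _ a b).2 hab
  have hcard := ncard_edgeSet_eq_of_iso (Iso.comap e G)
  refine ⟨φ, fun a ha => ?_, ?_, fun h => ?_⟩
  · have : φ a ∈ Uᶜ := by
      simp [φ, e]
    exact mem_compl.1 this ha
  · rw [← hcard]
    exact Set.ncard_le_ncard (edgeSet_mono hle) (Set.toFinite _)
  · rw [← hcard] at h
    have := edgeSet_injective (Set.eq_of_subset_of_ncard_le (edgeSet_mono hle) h (Set.toFinite _))
    rw [← this]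
    exact ⟨(Iso.comap e G).symm⟩

/-- Universal vertices can be added to `H` if the edges at them get new colours: they meet at most
`c` of the stars, so that the other stars form a rainbow family in `H`. -/
lemma hasRainbowFreeColoring_addUniversal {k m c r : ℕ} [Nonempty (Fin m)] {s : Fin k → ℕ}
    {H : SimpleGraph (Fin m)} {col : Sym2 (Fin m) → ℕ} (hcol : ProperOn H col)
    (hr : ∀ e ∈ H.edgeSet, col e < r)
    (hno : ∀ I x L, k ≤ c + #I → ¬ RainbowFamily H col s I x L) :
    HasRainbowFreeColoring (starForest s) (addUniversal c H) := by
  obtain ⟨ρ, hρ⟩ := exists_injective_nat (Sym2 (Fin c ⊕ Fin m))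
  let col' : Sym2 (Fin c ⊕ Fin m) → ℕ := fun e =>
    if h : ∃ e' : Sym2 (Fin m), e'.map Sum.inr = e then col h.choose else r + ρ e
  have hrr : ∀ a b, col' s(.inr a, .inr b) = col s(a, b) := by
    intro a b
    have h : ∃ e' : Sym2 (Fin m), e'.map Sum.inr = (s(.inr a, .inr b) : Sym2 (Fin c ⊕ Fin m)) :=
      ⟨s(a, b), rfl⟩
    have h' : h.choose = s(a, b) := Sym2.map.injective Sum.inr_injective h.choose_spec
    simp only [col', dif_pos h, h']
  have hl : ∀ a v, col' s(.inl a, v) = r + ρ s(.inl a, v) := by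
    intro a v
    have h : ¬ ∃ e' : Sym2 (Fin m), e'.map Sum.inr = (s(.inl a, v) : Sym2 (Fin c ⊕ Fin m)) := by
      rintro ⟨e', he⟩
      have : Sum.inl a ∈ e'.map (Sum.inr : Fin m → Fin c ⊕ Fin m) := by simp [he]
      simp at this
    simp only [col', dif_neg h]
  have hl' : ∀ a v, col' s(v, .inl a) = r + ρ s(v, .inl a) := by
    intro a v
    rw [Sym2.eq_swap, hl]
  have hinj : ∀ {u v w}, r + ρ s(u, v) = r + ρ s(u, w) → v = w := fun h =>
    Sym2.congr_right.1 (hρ (Nat.add_left_cancel h))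
  refine hasRainbowFreeColoring_iff.2 ⟨col', ?_, ?_⟩
  · rintro (u | u) v w hv hw h
    · rw [hl, hl] at h
      exact hinj h
    · rcases v with v | v <;> rcases w with w | w
      · rw [hl', hl'] at h
        exact hinj h
      · rw [hl', hrr] at h
        have := hr s(u, w) (by simpa using hw)
        omega
      · rw [hl', hrr] at h
        have := hr s(u, v) (by simpa using hv)
        omega
      · rw [hrr, hrr] at h
        rw [hcol (by simpa using hv) (by simpa using hw) h]
  · intro x L hF
    let I : Finset (Fin k) := {i | ∀ a : Fin c, x i ≠ .inl a ∧ .inl a ∉ L i}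
    have hI : #Iᶜ ≤ c := by
      have h := card_le_card_of_forall_subsingleton (s := Iᶜ) (t := univ)
        (fun i (a : Fin c) => x i = .inl a ∨ .inl a ∈ L i) (fun i hi => ?_) (fun a _ => ?_)
      · simpa using h
      · simp only [I, mem_compl, mem_filter, mem_univ, true_and, not_forall] at hi
        obtain ⟨a, ha⟩ := hi
        exact ⟨a, mem_univ a, by tauto⟩
      · rintro i ⟨-, hi⟩ j ⟨-, hj⟩
        have hij := hF.center_notMem i (mem_univ i) j (mem_univ j)
        have hji := hF.center_notMem j (mem_univ j) i (mem_univ i)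
        rcases hi with hi | hi <;> rcases hj with hj | hj
        · exact hF.center_inj i (mem_univ i) j (mem_univ j) (hi.trans hj.symm)
        · exact absurd (hi ▸ hj) hij
        · exact absurd (hj ▸ hi) hji
        · exact hF.leaf_inj i (mem_univ i) j (mem_univ j) _ hi hj
    have hI' : ∀ i ∈ I, ∀ a : Fin c, x i ≠ .inl a ∧ .inl a ∉ L i := fun i hi => by
      simpa only [I, mem_filter, mem_univ, true_and] using hi
    let x' : Fin k → Fin m := fun i => Sum.elim (fun _ => Classical.arbitrary _) id (x i)
    let L' : Fin k → Finset (Fin m) := fun i => {w | .inr w ∈ L i}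
    have hx' : ∀ i ∈ I, x i = .inr (x' i) := by
      intro i hi
      rcases hx : x i with a | a
      · exact absurd hx (hI' i hi a).1
      · simp [x', hx]
    have hL' : ∀ i w, w ∈ L' i ↔ .inr w ∈ L i := fun i w => by simp [L']
    have hL'map : ∀ i ∈ I, L i = (L' i).map .inr := by
      intro i hi
      ext (a | a)
      · simpa using (hI' i hi a).2
      · simp [hL']
    have hF' := hF.mono (subset_univ I)
    refine hno I x' L' ?_ ⟨?_, ?_, ?_, ?_, ?_, ?_⟩
    · have := card_add_card_compl I
      rw [Fintype.card_fin] at this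
      omega
    · intro i hi
      rw [← hF'.card_leaves i hi, hL'map i hi, card_map]
    · intro i hi w hw
      simpa [hx' i hi] using hF'.adj i hi _ ((hL' i w).1 hw)
    · intro i hi j hj h
      exact hF'.center_inj i hi j hj (by rw [hx' i hi, hx' j hj, h])
    · intro i hi j hj h
      exact hF'.center_notMem i hi j hj (by rw [hx' i hi, ← hL']; exact h)
    · intro i hi j hj w hwi hwj
      exact hF'.leaf_inj i hi j hj _ ((hL' i w).1 hwi) ((hL' j w).1 hwj)
    · intro i hi j hj w hw w' hw' h
      refine hF'.color_inj i hi j hj _ ((hL' i w).1 hw) _ ((hL' j w').1 hw') ?_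
      rw [hx' i hi, hx' j hj, hrr, hrr, h]

/-! ### The graphs `H_F(n, c)` -/

/-- Among the sums of `k - c` or more of the star sizes, the sum of the first `k - c` is the
smallest. -/
lemma sum_filter_lt_le {k c : ℕ} {s : Fin k → ℕ} (hmono : Monotone s) {I : Finset (Fin k)}
    (hI : k - c ≤ #I) : ∑ i with i.val < k - c, s i ≤ ∑ i ∈ I, s i := by
  set P : Finset (Fin k) := {i | i.val < k - c} with hP
  have hPc : #P = k - c := by
    rw [hP, Fin.card_filter_val_lt]
    omega
  rcases Nat.eq_zero_or_pos (k - c) with h0 | h0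
  · have : P = ∅ := card_eq_zero.1 (by omega)
    simp [this]
  let l : Fin k := ⟨k - c - 1, by omega⟩
  have h1 : #(P \ I) ≤ #(I \ P) := by
    have h2 := card_sdiff_add_card_inter P I
    have h3 := card_sdiff_add_card_inter I P
    rw [inter_comm I P] at h3
    omega
  have h2 : ∑ i ∈ P \ I, s i ≤ #(P \ I) * s l := by
    simpa using sum_le_card_nsmul (P \ I) s (s l) fun i hi => hmono (by
      have : i.val < k - c := by simpa [P] using (mem_sdiff.1 hi).1
      exact Fin.le_def.2 (show i.val ≤ k - c - 1 by omega))
  have h3 : #(I \ P) * s l ≤ ∑ i ∈ I \ P, s i := by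
    simpa using card_nsmul_le_sum (I \ P) s (s l) fun i hi => hmono (by
      have : ¬ i.val < k - c := by simpa [P] using (mem_sdiff.1 hi).2
      exact Fin.le_def.2 (show k - c - 1 ≤ i.val by omega))
  have h4 := sum_inter_add_sum_sdiff P I s
  have h5 := sum_inter_add_sum_sdiff I P s
  rw [inter_comm] at h5
  have := Nat.mul_le_mul_right (s l) h1
  omega

/-- The condition on the graph `H` in `H_F(n, c)` under which its number of edges is maximized. -/
def CoreCondition {k m : ℕ} (s : Fin k → ℕ) (c : ℕ) (H : SimpleGraph (Fin m)) : Prop :=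
  if c + 1 = k then ∀ v, H.degree v ≤ fval s c else H.lineGraph.Colorable (fval s c)

lemma isExtremal_iff [Fintype V] {G : SimpleGraph V} {p : SimpleGraph V → Prop} :
    G.IsExtremal p ↔ p G ∧ ∀ K, p K → K.edgeSet.ncard ≤ G.edgeSet.ncard := by
  have h : ∀ K : SimpleGraph V, K.edgeSet.ncard = #K.edgeFinset := fun K => by
    rw [← coe_edgeFinset, Set.ncard_coe_finset]
  refine and_congr_right fun _ => ⟨fun H K hK => ?_, fun H K _ hK => ?_⟩
  · rw [h, h]
    exact H hK
  · have := H K hK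
    rw [h, h] at this
    convert this

lemma isCore_iff {k m : ℕ} {s : Fin k → ℕ} {c : ℕ} {H : SimpleGraph (Fin m)} :
    IsCore s c H ↔ CoreCondition s c H ∧
      ∀ K : SimpleGraph (Fin m), CoreCondition s c K → K.edgeSet.ncard ≤ H.edgeSet.ncard := by
  unfold IsCore CoreCondition
  split_ifs with h
  · exact isExtremal_iff
  · exact isExtremal_iff

lemma one_le_sum_filter {k c : ℕ} {s : Fin k → ℕ} (hpos : ∀ i, 1 ≤ s i) (hc : c < k) :
    1 ≤ ∑ i with i.val < k - c, s i :=
  (hpos ⟨0, by omega⟩).trans (single_le_sum (f := s) (fun _ _ => Nat.zero_le _)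
    (mem_filter.2 ⟨mem_univ _, show 0 < k - c by omega⟩))

lemma CoreCondition.hasRainbowFreeColoring {k m c : ℕ} [Nonempty (Fin m)] {s : Fin k → ℕ}
    (hpos : ∀ i, 1 ≤ s i) (hmono : Monotone s) (hc : c < k) {H : SimpleGraph (Fin m)}
    (hH : CoreCondition s c H) : HasRainbowFreeColoring (starForest s) (addUniversal c H) := by
  have hsum := one_le_sum_filter hpos hc
  unfold CoreCondition at hH
  split_ifs at hH with hck
  · let e := Fintype.equivFin (Sym2 (Fin m))
    refine hasRainbowFreeColoring_addUniversal (col := fun x => e x)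
      (r := Fintype.card (Sym2 (Fin m))) (fun u v w _ _ h => ?_) (fun x _ => (e x).2) ?_
    · exact Sym2.congr_right.1 (e.injective (Fin.ext h))
    · intro I x L hI hF
      obtain ⟨i, hi⟩ : I.Nonempty := card_pos.1 (by omega)
      have h1 := sum_filter_lt_le (c := c) hmono (I := {i}) (by simp; omega)
      rw [sum_singleton, ← hF.card_leaves i hi] at h1
      have h2 : #(L i) ≤ H.degree (x i) := by
        rw [← card_neighborFinset_eq_degree]
        exact card_le_card fun w hw => (mem_neighborFinset _ _ _).2 (hF.adj i hi w hw)
      have h3 := hH (x i)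
      unfold fval at h3
      omega
  · obtain ⟨col, hcol, hr⟩ := exists_properOn_of_colorable hH
    refine hasRainbowFreeColoring_addUniversal hcol hr fun I x L hI hF => ?_
    have h1 := sum_filter_lt_le (c := c) hmono (I := I) (by omega)
    have h2 : #(I.biUnion fun i => (L i).image fun w => col s(x i, w)) = ∑ i ∈ I, s i := by
      rw [card_biUnion]
      · refine sum_congr rfl fun i hi => ?_
        rw [card_image_of_injOn, hF.card_leaves i hi]
        exact fun w hw w' hw' h => hcol (hF.adj i hi w hw) (hF.adj i hi w' hw') h
      · intro i hi j hj hij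
        refine disjoint_left.2 fun d hdi hdj => hij ?_
        obtain ⟨w, hw, rfl⟩ := mem_image.1 hdi
        obtain ⟨w', hw', h⟩ := mem_image.1 hdj
        exact hF.color_inj i hi j hj w hw w' hw' h.symm
    have h3 : (I.biUnion fun i => (L i).image fun w => col s(x i, w)) ⊆ range (fval s c) := by
      intro d hd
      obtain ⟨i, hi, hd⟩ := mem_biUnion.1 hd
      obtain ⟨w, hw, rfl⟩ := mem_image.1 hd
      exact mem_range.2 (hr _ (hF.adj i hi w hw))
    have h4 := card_le_card h3
    rw [card_range, h2] at h4
    unfold fval at h4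
    omega

/-- The vertices of large degree of a graph with a rainbow-free colouring are the `c < k` vertices
to be made universal: with them, a rainbow family of the `k - c` smallest stars in the rest `H` of
the graph could be completed. -/
lemma HasRainbowFreeColoring.exists_addUniversal {k : ℕ} {s : Fin k → ℕ} (hpos : ∀ i, 1 ≤ s i)
    (hmono : Monotone s) :
    ∃ N : ℕ, ∀ n, N ≤ n → ∀ G : SimpleGraph (Fin n), HasRainbowFreeColoring (starForest s) G →
      ∃ c < k, ∃ H : SimpleGraph (Fin (n - c)),
        (CoreCondition s c H ∨ H.edgeSet.ncard < fval s c * ((n - c) / 2)) ∧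
        G.edgeSet.ncard ≤ (addUniversal c H).edgeSet.ncard ∧
        ((addUniversal c H).edgeSet.ncard ≤ G.edgeSet.ncard → Nonempty (G ≃g addUniversal c H)) := by
  set E := ∑ i, s i with hE
  set M := 3 * E + 2 * k with hM
  refine ⟨(E + 1) * ((E + k) * (M + 1)) * M + E + k + 1, fun n hn G hG => ?_⟩
  obtain ⟨col, hcol, hno⟩ := hasRainbowFreeColoring_iff.1 hG
  have : Nonempty (Fin n) := ⟨⟨0, by omega⟩⟩
  have hno' : ¬ ∃ W C, HasRainbowStars G col s univ W C := by
    rintro ⟨W, C, h⟩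
    obtain ⟨x, L, hF, -⟩ := h.exists_family
    exact hno x L hF
  set U : Finset (Fin n) := {v | M ≤ G.degree v} with hU
  have hUdeg : ∀ u ∈ U, 3 * ∑ i, s i + 2 * Fintype.card (Fin k) ≤ G.degree u := fun u hu => by
    rw [Fintype.card_fin]
    exact (mem_filter.1 hu).2
  have hUk : #U < k := by
    by_contra! h
    obtain ⟨U', hU', hU'k⟩ := exists_subset_card_eq h
    exact hno' (HasRainbowStars.nil.extend_of_le_degree hcol (by simpa using hU'k) (by simp)
      fun u hu => hUdeg u (hU' hu))
  obtain ⟨c, hUc⟩ : ∃ c, #U = c := ⟨_, rfl⟩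
  rw [hUc] at hUk
  obtain ⟨φ, hφ, hcard, hiso⟩ := exists_comap_addUniversal G hUc
  obtain ⟨H, hH⟩ : ∃ H, H = G.comap φ := ⟨_, rfl⟩
  rw [← hH] at hcard hiso
  refine ⟨c, hUk, H, ?_, hcard, hiso⟩
  set J : Finset (Fin k) := {i | i.val < k - c} with hJ
  have hJc : #J = k - c := by
    rw [hJ, Fin.card_filter_val_lt]
    omega
  have hcolH : ProperOn H fun e => col (e.map φ) := fun u v w hv hw h => by
    rw [hH] at hv hw
    exact φ.injective (hcol hv hw h)
  have hnoH : ¬ ∃ W C, HasRainbowStars H (fun e => col (e.map φ)) s J W C := by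
    rintro ⟨W, C, h⟩
    rw [hH] at h
    refine hno' ((h.map φ).extend_of_le_degree hcol (U := U) ?_ (fun u hu huW => ?_) hUdeg)
    · have h1 : #U = #Jᶜ := by
        rw [card_compl, Fintype.card_fin, hUc, hJc]
        omega
      convert! h1
    · obtain ⟨a, -, rfl⟩ := mem_map.1 huW
      exact hφ a hu
  have hMH : ∀ v, H.degree v ≤ M := by
    intro v
    have h1 : H.degree v ≤ G.degree (φ v) := by
      rw [← card_neighborFinset_eq_degree, ← card_neighborFinset_eq_degree]
      refine card_le_card_of_injOn φ (fun w hw => ?_) φ.injective.injOn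
      simpa [hH] using hw
    have h2 : φ v ∉ U := hφ v
    simp only [U, mem_filter, mem_univ, true_and] at h2
    omega
  have hi₀ : (⟨0, by omega⟩ : Fin k) ∈ J := by
    simp only [J, mem_filter, mem_univ, true_and]
    omega
  unfold CoreCondition
  split_ifs with hck
  · left
    intro v
    by_contra! hv
    obtain ⟨i, hi⟩ : ∃ i, J = {i} := card_eq_one.1 (by omega)
    have hfv : fval s c = s i - 1 := by
      unfold fval
      rw [← hJ, hi, sum_singleton]
    have hsv : s i ≤ #(H.neighborFinset v) := by
      have := hpos i
      rw [card_neighborFinset_eq_degree]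
      omega
    obtain ⟨B, hB, hBc⟩ := exists_subset_card_eq hsv
    have hstar := HasRainbowStars.cons (G := H) (col := fun e => col (e.map φ)) i v B .nil
      (notMem_empty i) (notMem_empty v) (fun w hw => (mem_neighborFinset _ _ _).1 (hB hw)) hBc
      (by simp) (by simp)
    rw [insert_empty_eq, ← hi] at hstar
    exact hnoH ⟨_, _, hstar⟩
  · have hJE : ∑ i ∈ J, s i ≤ E := sum_le_sum_of_subset (subset_univ J)
    have hJE' : ∑ i ∈ J, (s i + 1) ≤ E + k := by
      refine (sum_le_sum_of_subset (subset_univ J)).trans ?_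
      simp [sum_add_distrib, E]
    have h := colorable_or_ncard_edgeSet_lt hcolH hMH hnoH hi₀ (hpos _)
      (fun i _ => hmono (Fin.le_def.2 (Nat.zero_le _))) (by omega) (by
        rw [Fintype.card_fin]
        have : (∑ i ∈ J, s i + 1) * ((∑ i ∈ J, (s i + 1)) * (M + 1)) * M ≤
            (E + 1) * ((E + k) * (M + 1)) * M := by gcongr
        omega)
    rwa [Fintype.card_fin] at h

/-! ### The number of edges of the graphs `H_F(n, c)` -/

lemma degree_le_of_colorable [Fintype V] {G : SimpleGraph V} {r : ℕ}
    (h : G.lineGraph.Colorable r) (v : V) : G.degree v ≤ r := by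
  obtain ⟨col, hcol, hr⟩ := exists_properOn_of_colorable h
  have h1 := hcol.card_filter_le v (range r)
  rw [filter_true_of_mem fun w hw => mem_range.2 (hr _ ((mem_neighborFinset _ _ _).1 hw)),
    card_neighborFinset_eq_degree, card_range] at h1
  exact h1

/-- Each of the `r` colour classes is a matching. -/
lemma ncard_edgeSet_le_of_colorable [Fintype V] {G : SimpleGraph V} {r : ℕ}
    (h : G.lineGraph.Colorable r) : G.edgeSet.ncard ≤ r * (Fintype.card V / 2) := by
  obtain ⟨col, hcol, hr⟩ := exists_properOn_of_colorable h
  rw [← coe_edgeFinset, Set.ncard_coe_finset,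
    card_eq_sum_card_fiberwise (f := col) (t := range r)
      fun e he => by simpa using hr e (by simpa using he)]
  have hclass : ∀ d ∈ range r, #{e ∈ G.edgeFinset | col e = d} ≤ Fintype.card V / 2 := by
    intro d _
    obtain ⟨K, hKadj⟩ : ∃ K : SimpleGraph V, ∀ u v, K.Adj u v ↔ G.Adj u v ∧ col s(u, v) = d :=
      ⟨{ Adj := fun u v => G.Adj u v ∧ col s(u, v) = d
         symm := ⟨fun u v h => ⟨h.1.symm, Sym2.eq_swap (a := u) ▸ h.2⟩⟩
         loopless := ⟨fun u h => h.1.ne rfl⟩ }, fun _ _ => Iff.rfl⟩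
    have hK : K.edgeSet = ↑({e ∈ G.edgeFinset | col e = d} : Finset (Sym2 V)) := by
      ext e
      induction e with | _ u v
      simp [hKadj]
    have h1 := two_mul_ncard_edgeSet K
    have h2 : ∑ v, K.degree v ≤ ∑ _v : V, 1 := by
      refine sum_le_sum fun v _ => ?_
      rw [← card_neighborFinset_eq_degree, card_le_one]
      intro a ha b hb
      rw [mem_neighborFinset, hKadj] at ha hb
      exact hcol ha.1 hb.1 (ha.2.trans hb.2.symm)
    rw [hK, Set.ncard_coe_finset] at h1
    simp only [sum_const, card_univ, smul_eq_mul, mul_one] at h2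
    omega
  simpa using sum_le_card_nsmul _ _ _ hclass

/-- The union of `r` disjoint matchings between `{0, …, h - 1}` and `{h, …, 2 h - 1}`, with
`h = m / 2`: the vertices `u` and `v` are joined if `v - u` modulo `h` is less than `r`, and this
residue is the colour of the edge. -/
lemma exists_colorable_le_ncard_edgeSet {m r : ℕ} (hr : 2 * r ≤ m) :
    ∃ K : SimpleGraph (Fin m), K.lineGraph.Colorable r ∧ r * (m / 2) ≤ K.edgeSet.ncard := by
  set h := m / 2 with hh
  let q : Fin m → Fin m → ℕ := fun a b => (max a.val b.val - min a.val b.val) % h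
  have hq : ∀ a b, q a b = q b a := fun a b => by simp only [q, max_comm, min_comm]
  let K : SimpleGraph (Fin m) :=
    { Adj := fun a b => ((a.val < h ∧ h ≤ b.val ∧ b.val < 2 * h) ∨
        (b.val < h ∧ h ≤ a.val ∧ a.val < 2 * h)) ∧ q a b < r
      symm := ⟨fun a b hab => ⟨hab.1.symm, hq a b ▸ hab.2⟩⟩
      loopless := ⟨fun a ha => by omega⟩ }
  let col : Sym2 (Fin m) → ℕ := Sym2.lift ⟨q, hq⟩
  have hmod : ∀ x y z : ℕ, h ≤ y → y < 2 * h → h ≤ z → z < 2 * h → x < h →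
      (y - x) % h = (z - x) % h → y = z := by
    intro x y z hy1 hy2 hz1 hz2 hx hyz
    have h1 : y ≡ z [MOD h] := by
      have : (y - x) + x ≡ (z - x) + x [MOD h] := Nat.ModEq.add_right x hyz
      rwa [Nat.sub_add_cancel (by omega), Nat.sub_add_cancel (by omega)] at this
    have h2 : y - h ≡ z - h [MOD h] := by
      refine Nat.ModEq.add_right_cancel' h ?_
      rwa [Nat.sub_add_cancel hy1, Nat.sub_add_cancel hz1]
    have := Nat.ModEq.eq_of_lt_of_lt h2 (by omega) (by omega)
    omega
  have hmod' : ∀ x y z : ℕ, h ≤ x → x < 2 * h → y < h → z < h →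
      (x - y) % h = (x - z) % h → y = z := by
    intro x y z hx1 hx2 hy hz hyz
    have h1 : (x - y) + (y + z) ≡ (x - z) + (y + z) [MOD h] := Nat.ModEq.add_right _ hyz
    have h2 : z + x ≡ y + x [MOD h] := by
      convert! h1 using 1 <;> omega
    exact (Nat.ModEq.eq_of_lt_of_lt (Nat.ModEq.add_right_cancel' x h2) hz hy).symm
  have hcol : ProperOn K col := by
    rintro u v w ⟨hv, -⟩ ⟨hw, -⟩ hvw
    have hvw : q u v = q u w := hvw
    simp only [q] at hvw
    apply Fin.ext
    rcases lt_or_ge u.val h with hu | hu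
    · rw [max_eq_right (by omega), min_eq_left (by omega), max_eq_right (by omega),
        min_eq_left (by omega)] at hvw
      exact hmod u v w (by omega) (by omega) (by omega) (by omega) hu hvw
    · rw [max_eq_left (by omega), min_eq_right (by omega), max_eq_left (by omega),
        min_eq_right (by omega)] at hvw
      exact hmod' u v w hu (by omega) (by omega) (by omega) hvw
  refine ⟨K, ?_, ?_⟩
  · simpa using hcol.colorable (C := range r) fun e he => by
      induction e with | _ u v
      exact mem_range.2 he.2
  · let g : Fin h × Fin r → Sym2 (Fin m) := fun p =>
      s(⟨p.1, by omega⟩, ⟨h + (p.1 + p.2) % h, by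
        have := Nat.mod_lt (p.1 + p.2) p.1.pos
        omega⟩)
    have hres : ∀ (u : Fin h) (j : Fin r), (h + (u.val + j.val) % h - u.val) % h = j := by
      intro u j
      have hj : j.val < h := by omega
      rcases lt_or_ge (u.val + j.val) h with hlt | hge
      · rw [Nat.mod_eq_of_lt hlt, show h + (u.val + j.val) - u.val = j + h by omega,
          Nat.add_mod_right, Nat.mod_eq_of_lt hj]
      · rw [Nat.mod_eq_sub_mod hge, Nat.mod_eq_of_lt (a := u.val + j.val - h) (by omega),
          show h + (u.val + j.val - h) - u.val = j by omega, Nat.mod_eq_of_lt hj]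
    have hginj : Function.Injective g := by
      rintro ⟨u, j⟩ ⟨u', j'⟩ hg
      rcases Sym2.eq_iff.1 hg with ⟨h1, h2⟩ | ⟨h1, h2⟩
      · have h1 : u.val = u'.val := congrArg (fun z : Fin m => z.val) h1
        have h2 : h + (u.val + j.val) % h = h + (u'.val + j'.val) % h := congrArg (fun z : Fin m => z.val) h2
        have h3 := hres u j
        rw [h2, h1, hres u' j'] at h3
        exact Prod.ext (Fin.ext h1) (Fin.ext h3.symm)
      · have h1 : u.val = h + (u'.val + j'.val) % h := congrArg (fun z : Fin m => z.val) h1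
        omega
    have hgK : Set.range g ⊆ K.edgeSet := by
      rintro _ ⟨⟨u, j⟩, rfl⟩
      have h1 := Nat.mod_lt (u.val + j.val) u.pos
      refine ⟨Or.inl ⟨u.2, Nat.le_add_right _ _, show h + (u.val + j.val) % h < 2 * h by omega⟩, ?_⟩
      simp only [q]
      rw [max_eq_right (by omega), min_eq_left (by omega), hres u j]
      exact j.2
    have h1 := Set.ncard_le_ncard hgK (Set.toFinite _)
    rw [← Set.image_univ, Set.ncard_image_of_injective _ hginj, Set.ncard_univ] at h1
    simpa [mul_comm] using h1

section cores

variable {k m c : ℕ} {s : Fin k → ℕ}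

lemma coreCondition_of_colorable {H : SimpleGraph (Fin m)}
    (h : H.lineGraph.Colorable (fval s c)) : CoreCondition s c H := by
  unfold CoreCondition
  split_ifs
  · exact degree_le_of_colorable h
  · exact h

lemma exists_isCore (s : Fin k → ℕ) (c m : ℕ) : ∃ H : SimpleGraph (Fin m), IsCore s c H := by
  have hbot : CoreCondition s c (⊥ : SimpleGraph (Fin m)) := by
    refine coreCondition_of_colorable (Colorable.mono (Nat.zero_le _)
      (ProperOn.colorable (col := 0) (C := ∅) ?_ ?_))
    · rintro u v w ⟨⟩
    · simp
  obtain ⟨H, hH, hmax⟩ := Set.exists_max_image {H : SimpleGraph (Fin m) | CoreCondition s c H}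
    (fun H => H.edgeSet.ncard) (Set.toFinite _) ⟨⊥, hbot⟩
  exact ⟨H, isCore_iff.2 ⟨hH, hmax⟩⟩

/-- The number of edges of the graph `H` in `H_F(n, c)`, for `m = n - c`. -/
noncomputable def coreEdges (s : Fin k → ℕ) (c m : ℕ) : ℕ :=
  (exists_isCore s c m).choose.edgeSet.ncard

lemma CoreCondition.ncard_edgeSet_le {H : SimpleGraph (Fin m)} (hH : CoreCondition s c H) :
    H.edgeSet.ncard ≤ coreEdges s c m :=
  (isCore_iff.1 (exists_isCore s c m).choose_spec).2 H hH

lemma isCore_iff_ncard_edgeSet {H : SimpleGraph (Fin m)} :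
    IsCore s c H ↔ CoreCondition s c H ∧ H.edgeSet.ncard = coreEdges s c m := by
  have h := isCore_iff.1 (exists_isCore s c m).choose_spec
  constructor
  · intro hH
    exact ⟨(isCore_iff.1 hH).1, le_antisymm (isCore_iff.1 hH).1.ncard_edgeSet_le
      ((isCore_iff.1 hH).2 _ h.1)⟩
  · rintro ⟨hH, hcard⟩
    exact isCore_iff.2 ⟨hH, fun K hK => hcard ▸ hK.ncard_edgeSet_le⟩

lemma le_coreEdges (h : 2 * fval s c ≤ m) : fval s c * (m / 2) ≤ coreEdges s c m := by
  obtain ⟨K, hK, hcard⟩ := exists_colorable_le_ncard_edgeSet h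
  exact hcard.trans (coreCondition_of_colorable hK).ncard_edgeSet_le

lemma coreEdges_le (hc : c + 1 ≠ k) : coreEdges s c m ≤ fval s c * (m / 2) := by
  have h := (isCore_iff.1 (exists_isCore s c m).choose_spec).1
  unfold CoreCondition at h
  rw [if_neg hc] at h
  exact (ncard_edgeSet_le_of_colorable h).trans_eq (by rw [Fintype.card_fin])

lemma two_mul_coreEdges_le : 2 * coreEdges s c m ≤ fval s c * m := by
  have h := (isCore_iff.1 (exists_isCore s c m).choose_spec).1
  have hdeg : ∀ v, (exists_isCore s c m).choose.degree v ≤ fval s c := by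
    unfold CoreCondition at h
    split_ifs at h
    · exact h
    · exact degree_le_of_colorable h
  unfold coreEdges
  rw [two_mul_ncard_edgeSet]
  refine (sum_le_sum fun v _ => hdeg v).trans ?_
  simp [mul_comm]

/-- Twice the number of edges of the graphs `H_F(n, c)`. -/
noncomputable def hEdges (s : Fin k → ℕ) (n c : ℕ) : ℕ :=
  c * (n - 1) + (n - c) * c + 2 * coreEdges s c (n - c)

lemma two_mul_ncard_edgeSet_addUniversal_sub {n : ℕ} (hc : c ≤ n) (H : SimpleGraph (Fin (n - c))) :
    2 * (addUniversal c H).edgeSet.ncard = c * (n - 1) + (n - c) * c + 2 * H.edgeSet.ncard := by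
  rw [two_mul_ncard_edgeSet_addUniversal, Nat.add_sub_of_le hc]

lemma IsHGraph.two_mul_ncard_edgeSet {n : ℕ} (hc : c ≤ n) {G : SimpleGraph (Fin n)}
    (hG : IsHGraph s c G) : 2 * G.edgeSet.ncard = hEdges s n c := by
  obtain ⟨H, hH, ⟨e⟩⟩ := hG
  rw [ncard_edgeSet_eq_of_iso e, two_mul_ncard_edgeSet_addUniversal_sub hc,
    (isCore_iff_ncard_edgeSet.1 hH).2, hEdges]

lemma exists_isHGraph (s : Fin k → ℕ) {n : ℕ} (hc : c ≤ n) :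
    ∃ G : SimpleGraph (Fin n), IsHGraph s c G := by
  obtain ⟨H, hH⟩ := exists_isCore s c (n - c)
  let e : Fin n ≃ Fin c ⊕ Fin (n - c) := Fintype.equivOfCardEq (by simp; omega)
  exact ⟨_, H, hH, ⟨Iso.comap e _⟩⟩

lemma HasRainbowFreeColoring.of_iso {W : Type*} {G : SimpleGraph V} {G' : SimpleGraph W}
    (hG' : HasRainbowFreeColoring (starForest s) G') (e : G ≃g G') :
    HasRainbowFreeColoring (starForest s) G := by
  obtain ⟨col, hcol, hno⟩ := hasRainbowFreeColoring_iff.1 hG'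
  refine hasRainbowFreeColoring_iff.2 ⟨fun x => col (x.map e), fun u v w hv hw h => ?_,
    fun x L hF => hno (fun i => e (x i)) (fun i => (L i).map e.toEquiv.toEmbedding) ?_⟩
  · exact e.injective (hcol (e.map_adj_iff.2 hv) (e.map_adj_iff.2 hw) h)
  · refine ⟨fun i hi => by rw [card_map, hF.card_leaves i hi], ?_, ?_, ?_, ?_, ?_⟩
    · intro i hi w hw
      rw [mem_map] at hw
      obtain ⟨w, hw, rfl⟩ := hw
      exact e.map_adj_iff.2 (hF.adj i hi w hw)
    · exact fun i hi j hj h => hF.center_inj i hi j hj (e.injective h)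
    · intro i hi j hj h
      obtain ⟨w, hw, h⟩ := mem_map.1 h
      obtain rfl := e.injective h
      exact hF.center_notMem i hi j hj hw
    · intro i hi j hj w hwi hwj
      obtain ⟨w, hw, rfl⟩ := mem_map.1 hwi
      obtain ⟨w', hw', h⟩ := mem_map.1 hwj
      obtain rfl := e.injective h
      exact hF.leaf_inj i hi j hj _ hw hw'
    · intro i hi j hj w hw w' hw' h
      rw [mem_map] at hw
      obtain ⟨w, hw, rfl⟩ := hw
      rw [mem_map] at hw'
      obtain ⟨w', hw', rfl⟩ := hw'
      exact hF.color_inj i hi j hj w hw w' hw' h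

lemma IsHGraph.hasRainbowFreeColoring {n : ℕ} (hpos : ∀ i, 1 ≤ s i) (hmono : Monotone s)
    (hc : c < k) (hcn : c < n) {G : SimpleGraph (Fin n)} (hG : IsHGraph s c G) :
    HasRainbowFreeColoring (starForest s) G := by
  obtain ⟨H, hH, ⟨e⟩⟩ := hG
  have : Nonempty (Fin (n - c)) := ⟨⟨0, by omega⟩⟩
  exact ((isCore_iff.1 hH).1.hasRainbowFreeColoring hpos hmono hc).of_iso e

lemma fval_add_one (hpos : ∀ i, 1 ≤ s i) (hc : c < k) :
    fval s c + 1 = ∑ i with i.val < k - c, s i := by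
  have := one_le_sum_filter hpos hc
  unfold fval
  omega

lemma fval_le_sum : fval s c ≤ ∑ i, s i :=
  (Nat.sub_le _ _).trans (sum_le_sum_of_subset (subset_univ _))

/-- The extremal graphs are the graphs `H_F(n, c)` for those `c` that maximize the number of
edges. -/
theorem isRainbowExtremal_iff (hpos : ∀ i, 1 ≤ s i) (hmono : Monotone s) :
    ∃ N : ℕ, ∀ n, N ≤ n → ∀ G : SimpleGraph (Fin n), IsRainbowExtremal (starForest s) G ↔
      ∃ c < k, IsHGraph s c G ∧ ∀ c' < k, hEdges s n c' ≤ hEdges s n c := by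
  obtain ⟨N, hN⟩ := HasRainbowFreeColoring.exists_addUniversal hpos hmono
  refine ⟨N + k + 2 * ∑ i, s i, fun n hn G => ?_⟩
  have hfree : ∀ c < k, ∀ K : SimpleGraph (Fin n), IsHGraph s c K →
      HasRainbowFreeColoring (starForest s) K := fun c hc K hK =>
    hK.hasRainbowFreeColoring hpos hmono hc (by omega)
  unfold IsRainbowExtremal
  rw [isExtremal_iff]
  have hbound : ∀ (c : ℕ) (_ : c < k) (H : SimpleGraph (Fin (n - c))),
      (CoreCondition s c H ∨ H.edgeSet.ncard < fval s c * ((n - c) / 2)) →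
      H.edgeSet.ncard ≤ coreEdges s c (n - c) ∧
        (coreEdges s c (n - c) ≤ H.edgeSet.ncard → IsCore s c H) := by
    rintro c hc H (h | h)
    · exact ⟨h.ncard_edgeSet_le,
        fun h' => isCore_iff_ncard_edgeSet.2 ⟨h, le_antisymm h.ncard_edgeSet_le h'⟩⟩
    · have h1 := fval_le_sum (s := s) (c := c)
      have h2 := h.trans_le (le_coreEdges (by omega))
      exact ⟨h2.le, fun h' => absurd h2 (not_lt.2 h')⟩
  constructor
  · rintro ⟨hG, hmax⟩
    obtain ⟨c, hc, H, hH, hcard, hiso⟩ := hN n (by omega) G hG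
    have hH' := hbound c hc H hH
    have hmax' : ∀ c' < k, hEdges s n c' ≤ 2 * G.edgeSet.ncard := by
      intro c' hc'
      obtain ⟨K, hK⟩ := exists_isHGraph s (show c' ≤ n by omega)
      rw [← hK.two_mul_ncard_edgeSet (by omega)]
      exact Nat.mul_le_mul_left 2 (hmax K (hfree c' hc' K hK))
    have h1 := hmax' c hc
    have h2 := two_mul_ncard_edgeSet_addUniversal_sub (show c ≤ n by omega) H
    unfold hEdges at h1
    have hGc : IsHGraph s c G := ⟨H, hH'.2 (by omega), hiso (by omega)⟩
    refine ⟨c, hc, hGc, fun c' hc' => ?_⟩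
    rw [← hGc.two_mul_ncard_edgeSet (by omega)]
    exact hmax' c' hc'
  · rintro ⟨c, hc, hG, hmax⟩
    refine ⟨hfree c hc G hG, fun K hK => ?_⟩
    obtain ⟨c', hc', H, hH, hcard, -⟩ := hN n (by omega) K hK
    have hH' := hbound c' hc' H hH
    have h1 := hmax c' hc'
    have h2 := two_mul_ncard_edgeSet_addUniversal_sub (show c' ≤ n by omega) H
    rw [← hG.two_mul_ncard_edgeSet (by omega)] at h1
    unfold hEdges at h1
    omega

/-! ### Comparing the numbers of edges for different `c` -/

lemma hEdges_le {n : ℕ} (hc : c ≤ n) (hn : 1 ≤ n) :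
    (hEdges s n c : ℤ) ≤ 2 * c * n - c - c ^ 2 + fval s c * (n - c) := by
  obtain ⟨m, rfl⟩ := Nat.exists_eq_add_of_le hc
  have h := two_mul_coreEdges_le (s := s) (c := c) (m := m)
  unfold hEdges
  rw [Nat.add_sub_cancel_left]
  zify [hn] at h ⊢
  linarith

lemma le_hEdges {n : ℕ} (hc : c ≤ n) (hn : 1 ≤ n) (hf : 2 * fval s c + c ≤ n) :
    2 * c * n - c - c ^ 2 + fval s c * (2 * ((n - c) / 2 : ℕ)) ≤ (hEdges s n c : ℤ) := by
  have h := le_coreEdges (s := s) (c := c) (m := n - c) (by omega)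
  unfold hEdges
  generalize (n - c) / 2 = p at *
  zify [hn, hc] at h ⊢
  linarith

/-- For large `n` the number of edges is governed by the coefficient `(2 c + f(c)) / 2` of `n`. -/
lemma hEdges_lt_hEdges {n c' : ℕ} (hc : c < k) (hc' : c' < k)
    (hn : k + k ^ 2 + 2 * ((∑ i, s i) * (k + 1)) < n)
    (h : 2 * c + fval s c < 2 * c' + fval s c') : hEdges s n c < hEdges s n c' := by
  have hf' := fval_le_sum (s := s) (c := c')
  have hE : ∑ i, s i ≤ (∑ i, s i) * (k + 1) := Nat.le_mul_of_pos_right _ (Nat.succ_pos k)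
  have h1 := hEdges_le (s := s) (hc.le.trans (by omega : k ≤ n)) (by omega)
  have h2 := le_hEdges (s := s) (show c' ≤ n by omega) (by omega) (by omega)
  have h3 : (n : ℤ) - c' - 1 ≤ 2 * ((n - c') / 2 : ℕ) := by omega
  have h4 : fval s c' * (c' + 1) ≤ (∑ i, s i) * (k + 1) := Nat.mul_le_mul hf' (by omega)
  have h5 : c' ^ 2 ≤ k ^ 2 := Nat.pow_le_pow_left hc'.le 2
  have h6 : (fval s c' : ℤ) * (n - c' - 1) ≤ fval s c' * (2 * ((n - c') / 2 : ℕ)) :=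
    mul_le_mul_of_nonneg_left h3 (by positivity)
  have h7 : (2 * c + fval s c + 1 : ℤ) * n ≤ (2 * c' + fval s c') * n :=
    mul_le_mul_of_nonneg_right (by omega) (by positivity)
  have h8 : (0 : ℤ) ≤ fval s c * c := by positivity
  have h9 : (0 : ℤ) ≤ (c : ℤ) ^ 2 := by positivity
  zify at h4 h5 hn ⊢
  have h10 : (0 : ℤ) ≤ (∑ i, (s i : ℤ)) * (k + 1) := by positivity
  have h11 : (c' : ℤ) < k := by exact_mod_cast hc'
  nlinarith

end cores

section compare

variable {k c : ℕ} {s : Fin k → ℕ}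

lemma card_filter_not_val_lt (hc : c ≤ k) : #{i : Fin k | ¬ i.val < k - c} = c := by
  have h := card_filter_add_card_filter_not (s := (univ : Finset (Fin k))) fun i => i.val < k - c
  rw [Fin.card_filter_val_lt, card_univ, Fintype.card_fin] at h
  omega

lemma fval_zero_eq (hpos : ∀ i, 1 ≤ s i) (hc : c < k) :
    fval s 0 = fval s c + ∑ i with ¬ i.val < k - c, s i := by
  have h1 := fval_add_one hpos hc
  have h2 := fval_add_one hpos (show 0 < k by omega)
  have h3 := sum_filter_add_sum_filter_not univ (fun i : Fin k => i.val < k - c) s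
  have h4 : ∑ i : Fin k with i.val < k - 0, s i = ∑ i, s i := by
    rw [filter_true_of_mem fun i _ => by omega]
  omega

lemma fval_eq_add (hpos : ∀ i, 1 ≤ s i) (hc : c < k) :
    fval s c = fval s (k - 1) + ∑ i : Fin k with i.val < k - c ∧ i.val ≠ 0, s i := by
  have h1 := fval_add_one hpos hc
  have h2 := fval_add_one hpos (show k - 1 < k by omega)
  have h3 := sum_filter_add_sum_filter_not (univ.filter fun i : Fin k => i.val < k - c)
    (fun i : Fin k => i.val < k - (k - 1)) s
  rw [filter_filter, filter_filter] at h3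
  have h4 : (univ.filter fun i : Fin k => i.val < k - c ∧ i.val < k - (k - 1)) =
      univ.filter fun i : Fin k => i.val < k - (k - 1) := by
    ext i
    simp only [mem_filter, mem_univ, true_and]
    omega
  have h5 : (univ.filter fun i : Fin k => i.val < k - c ∧ ¬ i.val < k - (k - 1)) =
      univ.filter fun i : Fin k => i.val < k - c ∧ i.val ≠ 0 := by
    ext i
    simp only [mem_filter, mem_univ, true_and]
    omega
  rw [h4, h5] at h3
  omega

lemma card_filter_val_lt_ne_zero (hc : c < k) :
    #{i : Fin k | i.val < k - c ∧ i.val ≠ 0} = k - c - 1 := by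
  have h : ({i : Fin k | i.val < k - c ∧ i.val ≠ 0} : Finset (Fin k)) =
      ({i | i.val < k - c} : Finset (Fin k)).erase ⟨0, by omega⟩ := by
    ext i
    simp [Fin.ext_iff, and_comm]
  rw [h, card_erase_of_mem (by simp; omega), Fin.card_filter_val_lt]
  omega

lemma sum_eq_two_mul_card {ι : Type*} {A : Finset ι} {t : ι → ℕ} (h : ∀ i ∈ A, t i = 2) :
    ∑ i ∈ A, t i = 2 * #A := by
  rw [sum_congr rfl h, sum_const, smul_eq_mul, mul_comm]

lemma two_mul_card_lt_sum {ι : Type*} {A : Finset ι} {t : ι → ℕ} (h : ∀ i ∈ A, 2 ≤ t i)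
    {j : ι} (hj : j ∈ A) (hj3 : 3 ≤ t j) : 2 * #A < ∑ i ∈ A, t i := by
  have := sum_lt_sum (f := fun _ => 2) h ⟨j, hj, hj3⟩
  simpa [mul_comm] using this

lemma sum_lt_two_mul_card {ι : Type*} {A : Finset ι} {t : ι → ℕ} (h : ∀ i ∈ A, t i ≤ 2)
    {j : ι} (hj : j ∈ A) (hj1 : t j ≤ 1) : ∑ i ∈ A, t i < 2 * #A := by
  have := sum_lt_sum (g := fun _ => 2) h ⟨j, hj, by omega⟩
  simpa [mul_comm] using this

lemma fval_of_forall_eq_two (h2 : ∀ i, s i = 2) (hc : c < k) : fval s c + 1 = 2 * (k - c) := by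
  rw [fval_add_one (fun i => by rw [h2]; norm_num) hc, sum_eq_two_mul_card fun i _ => h2 i,
    Fin.card_filter_val_lt, min_eq_right (Nat.sub_le k c)]

/-- If every star has at least two edges, then `2 c + f(c)` is largest for `c = 0`, and it takes this
value again only if all stars have exactly two edges. -/
lemma hEdges_lt_of_forall_two_le {n : ℕ} (hmono : Monotone s) (h2 : ∀ i, 2 ≤ s i) (hc0 : 0 < c)
    (hc : c < k) (hn : k + k ^ 2 + 2 * ((∑ i, s i) * (k + 1)) < n) :
    hEdges s n c < hEdges s n 0 ∨ (Odd n ∧ (∀ i, s i = 2) ∧ c = 1) := by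
  have hpos : ∀ i, 1 ≤ s i := fun i => (h2 i).trans' (by norm_num)
  by_cases hall : ∀ i, s i = 2
  · have hf := fval_of_forall_eq_two hall hc
    have hf0 := fval_of_forall_eq_two hall (hc0.trans hc)
    have hE := fval_le_sum (s := s) (c := 0)
    have hE' : ∑ i, s i ≤ (∑ i, s i) * (k + 1) := Nat.le_mul_of_pos_right _ (Nat.succ_pos k)
    have h1 := hEdges_le (s := s) (show c ≤ n by omega) (by omega)
    have h3 := le_hEdges (s := s) (Nat.zero_le n) (by omega) (by omega)
    obtain ⟨d, rfl⟩ : ∃ d, k = c + 1 + d := ⟨k - c - 1, by omega⟩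
    rw [show fval s c = 2 * d + 1 by omega] at h1
    rw [show fval s 0 = 2 * c + 2 * d + 1 by omega, Nat.sub_zero] at h3
    rcases Nat.even_or_odd' n with ⟨p, rfl | rfl⟩
    · left
      rw [Nat.mul_div_cancel_left p two_pos] at h3
      zify at hc0 ⊢
      push_cast at h1 h3
      nlinarith
    · by_cases hc1 : c = 1
      · exact Or.inr ⟨odd_two_mul_add_one p, hall, hc1⟩
      · left
        rw [show (2 * p + 1) / 2 = p by omega] at h3
        have hc2 : 2 ≤ c := by omega
        zify at hc2 ⊢
        push_cast at h1 h3
        nlinarith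
  · push Not at hall
    obtain ⟨j, hj⟩ := hall
    left
    refine hEdges_lt_hEdges hc (hc0.trans hc) hn ?_
    have hlast : 3 ≤ s ⟨k - 1, by omega⟩ := by
      have h3 := h2 j
      have h4 : s j ≤ s ⟨k - 1, by omega⟩ := hmono (Fin.le_def.2 (show j.val ≤ k - 1 by omega))
      omega
    have h3 := two_mul_card_lt_sum (A := {i : Fin k | ¬ i.val < k - c}) (fun i _ => h2 i)
      (by simp only [mem_filter, mem_univ, true_and]; omega) hlast
    rw [card_filter_not_val_lt hc.le] at h3
    have h4 := fval_zero_eq hpos hc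
    omega

/-- If all stars have two edges and `n` is odd, the parity loss in the matchings of `H_F(n, 0)`
equals what the universal vertex of `H_F(n, 1)` costs. -/
lemma hEdges_one_eq {n : ℕ} (h2 : ∀ i, s i = 2) (hk : 2 ≤ k) (hodd : Odd n)
    (hn : k + k ^ 2 + 2 * ((∑ i, s i) * (k + 1)) < n) : hEdges s n 1 = hEdges s n 0 := by
  have hE := fval_le_sum (s := s) (c := 1)
  have hE' := fval_le_sum (s := s) (c := 0)
  have hE'' : ∑ i, s i ≤ (∑ i, s i) * (k + 1) := Nat.le_mul_of_pos_right _ (Nat.succ_pos k)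
  have hf0 := fval_of_forall_eq_two h2 (show 0 < k by omega)
  have hf1 := fval_of_forall_eq_two h2 (show 1 < k by omega)
  obtain ⟨p, rfl⟩ := hodd
  have h1 := le_coreEdges (s := s) (c := 0) (m := 2 * p + 1) (by omega)
  have h3 := coreEdges_le (s := s) (c := 0) (m := 2 * p + 1) (by omega)
  have h4 := le_coreEdges (s := s) (c := 1) (m := 2 * p) (by omega)
  have h5 := two_mul_coreEdges_le (s := s) (c := 1) (m := 2 * p)
  rw [show (2 * p + 1) / 2 = p by omega] at h1 h3
  rw [show (2 * p) / 2 = p by omega] at h4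
  obtain ⟨d, rfl⟩ : ∃ d, k = d + 2 := ⟨k - 2, by omega⟩
  rw [show fval s 0 = 2 * d + 3 by omega] at h1 h3
  rw [show fval s 1 = 2 * d + 1 by omega] at h4 h5
  unfold hEdges
  simp only [Nat.sub_zero, Nat.add_sub_cancel]
  nlinarith

/-- The number `2 c + f(c)` is a convex function of `c`, so that at an inner `c` it is at most the
larger of its values at `0` and `k - 1`, with equality only if it is constant, that is, if all stars
but the smallest have two edges. In that case the bounded terms are compared. -/
lemma hEdges_lt_of_exists_eq_one {n : ℕ} (hpos : ∀ i, 1 ≤ s i) (hmono : Monotone s)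
    (h1 : ∃ i, s i = 1) (hc0 : 0 < c) (hc : c + 1 < k)
    (hn : k + k ^ 2 + 2 * ((∑ i, s i) * (k + 1)) < n) :
    hEdges s n c < hEdges s n 0 ∨ hEdges s n c < hEdges s n (k - 1) ∨
      (Odd n ∧ (∀ i : Fin k, s i = if (i : ℕ) = 0 then 1 else 2) ∧ c = 1 ∧
        hEdges s n c ≤ hEdges s n 0) := by
  have hck : c < k := by omega
  by_cases hg0 : 2 * c + fval s c < 2 * 0 + fval s 0
  · exact Or.inl (hEdges_lt_hEdges hck (by omega) hn hg0)
  by_cases hg1 : 2 * c + fval s c < 2 * (k - 1) + fval s (k - 1)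
  · exact Or.inr (Or.inl (hEdges_lt_hEdges hck (by omega) hn hg1))
  have hf0 := fval_zero_eq hpos hck
  have hf1 := fval_eq_add hpos hck
  have hcardQ := card_filter_not_val_lt hck.le
  have hcardP := card_filter_val_lt_ne_zero hck
  set Q : Finset (Fin k) := {i | ¬ i.val < k - c} with hQ
  set P : Finset (Fin k) := {i | i.val < k - c ∧ i.val ≠ 0} with hP
  have hQmem : ∀ i, i ∈ Q ↔ ¬ i.val < k - c := fun i => by simp [Q]
  have hPmem : ∀ i, i ∈ P ↔ i.val < k - c ∧ i.val ≠ 0 := fun i => by simp [P]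
  let l : Fin k := ⟨k - c, by omega⟩
  let l' : Fin k := ⟨k - c - 1, by omega⟩
  have hlQ : l ∈ Q := (hQmem l).2 (lt_irrefl _)
  have hlP : l' ∈ P := (hPmem l').2 ⟨by simp only [l']; omega, by simp only [l']; omega⟩
  have hll' : s l' ≤ s l := hmono (Fin.le_def.2 (Nat.sub_le _ _))
  have hQl : ∀ i ∈ Q, s l ≤ s i := fun i hi =>
    hmono (Fin.le_def.2 (not_lt.1 ((hQmem i).1 hi)))
  have hPl : ∀ i ∈ P, s i ≤ s l' := fun i hi =>
    hmono (Fin.le_def.2 (Nat.le_sub_one_of_lt ((hPmem i).1 hi).1))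
  -- The sizes in `Q` add up to at most `2 * #Q` and those in `P` to at least `2 * #P`, and every
  -- size in `P` is at most every size in `Q`: so they all equal two.
  have hl2 : s l ≤ 2 := by
    by_contra! h
    have := two_mul_card_lt_sum (t := s) (fun i hi => h.le.trans (hQl i hi)) hlQ h
    omega
  have hl'2 : 2 ≤ s l' := by
    by_contra! h
    have := sum_lt_two_mul_card (t := s) (fun i hi => (hPl i hi).trans h.le) hlP (by omega)
    omega
  have hQ2 : ∀ i ∈ Q, s i = 2 := by
    intro i hi
    have h3 := hQl i hi
    by_contra hne
    have := two_mul_card_lt_sum (t := s) (fun i hi => by have := hQl i hi; omega) hi (by omega)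
    omega
  have hP2 : ∀ i ∈ P, s i = 2 := by
    intro i hi
    have h3 := hPl i hi
    by_contra hne
    have := sum_lt_two_mul_card (t := s) (fun i hi => by have := hPl i hi; omega) hi (by omega)
    omega
  have hs0 : s ⟨0, by omega⟩ = 1 := by
    obtain ⟨i, hi⟩ := h1
    have h3 := hpos ⟨0, by omega⟩
    have h4 : s ⟨0, by omega⟩ ≤ s i := hmono (Fin.le_def.2 (Nat.zero_le _))
    omega
  have hs : ∀ i : Fin k, s i = if (i : ℕ) = 0 then 1 else 2 := by
    intro i
    split_ifs with hi
    · rw [← hs0]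
      exact congrArg s (Fin.ext hi)
    · by_cases h : i.val < k - c
      · exact hP2 i ((hPmem i).2 ⟨h, hi⟩)
      · exact hQ2 i ((hQmem i).2 h)
  have hflast : fval s (k - 1) = 0 := by
    have h3 := fval_add_one hpos (show k - 1 < k by omega)
    have h4 := sum_filter_lt_le (c := k - 1) hmono (I := {⟨0, by omega⟩}) (by simp; omega)
    rw [sum_singleton, hs0] at h4
    omega
  rw [sum_eq_two_mul_card hP2, hcardP, hflast] at hf1
  rw [sum_eq_two_mul_card hQ2, hcardQ] at hf0
  have hE := fval_le_sum (s := s) (c := 0)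
  have hE' : ∑ i, s i ≤ (∑ i, s i) * (k + 1) := Nat.le_mul_of_pos_right _ (Nat.succ_pos k)
  have h5 := hEdges_le (s := s) (show c ≤ n by omega) (by omega)
  have h6 := le_hEdges (s := s) (Nat.zero_le n) (by omega) (by omega)
  obtain ⟨d, rfl⟩ : ∃ d, k = c + 2 + d := ⟨k - c - 2, by omega⟩
  rw [show fval s c = 2 * d + 2 by omega] at h5
  rw [show fval s 0 = 2 * c + 2 * d + 2 by omega, Nat.sub_zero] at h6
  rcases Nat.even_or_odd' n with ⟨p, rfl | rfl⟩
  · left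
    rw [Nat.mul_div_cancel_left p two_pos] at h6
    zify at hc0 ⊢
    push_cast at h5 h6
    nlinarith
  · rw [show (2 * p + 1) / 2 = p by omega] at h6
    by_cases hc1 : c = 1
    · refine Or.inr (Or.inr ⟨odd_two_mul_add_one p, hs, hc1, ?_⟩)
      zify
      subst hc1
      push_cast at h5 h6
      linarith
    · left
      have hc2 : 2 ≤ c := by omega
      zify at hc2 ⊢
      push_cast at h5 h6
      nlinarith

end compare

end RainbowStars

theorem mainTheorem1 (k : ℕ) (hk : 1 ≤ k) (s : Fin k → ℕ) (hpos : ∀ i, 1 ≤ s i)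
    (hmono : Monotone s) :
    ∃ N : ℕ, ∀ n : ℕ, N ≤ n →
      -- every extremal graph is one of the graphs `H_F(n,c)`
      (∀ G : SimpleGraph (Fin n),
        RainbowStars.IsRainbowExtremal (RainbowStars.starForest s) G →
          ∃ c : ℕ, c ≤ k - 1 ∧ RainbowStars.IsHGraph s c G) ∧
      -- no star of size one
      ((∀ i, s i ≠ 1) → ∀ G : SimpleGraph (Fin n),
        (RainbowStars.IsRainbowExtremal (RainbowStars.starForest s) G ↔
          RainbowStars.IsHGraph s 0 G ∨
          (2 ≤ k ∧ Odd n ∧ (∀ i, s i = 2) ∧ RainbowStars.IsHGraph s 1 G))) ∧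
      -- some star of size one
      ((∃ i, s i = 1) → ∀ G : SimpleGraph (Fin n),
        (RainbowStars.IsRainbowExtremal (RainbowStars.starForest s) G ↔
          (RainbowStars.IsHGraph s 0 G ∨ RainbowStars.IsHGraph s (k - 1) G ∨
            (3 ≤ k ∧ Odd n ∧ (∀ i : Fin k, s i = if (i : ℕ) = 0 then 1 else 2) ∧
              RainbowStars.IsHGraph s 1 G)) ∧
          ∀ G' : SimpleGraph (Fin n),
            RainbowStars.IsHGraph s 0 G' ∨ RainbowStars.IsHGraph s (k - 1) G' →
              G'.edgeSet.ncard ≤ G.edgeSet.ncard)) := by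
  obtain ⟨N, hN⟩ := RainbowStars.isRainbowExtremal_iff hpos hmono
  refine ⟨N + (k + k ^ 2 + 2 * ((∑ i, s i) * (k + 1))) + 1, fun n hn => ⟨?_, ?_, ?_⟩⟩
  · intro G hG
    obtain ⟨c, hc, hGc, -⟩ := (hN n (by omega) G).1 hG
    exact ⟨c, by omega, hGc⟩
  · intro h1 G
    rw [hN n (by omega) G]
    have h2 : ∀ i, 2 ≤ s i := fun i => by
      have := hpos i
      have := h1 i
      omega
    have hlt := fun c hc0 hc => RainbowStars.hEdges_lt_of_forall_two_le (c := c) (n := n) hmono h2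
      hc0 hc (by omega)
    have hmax : ∀ c' < k, RainbowStars.hEdges s n c' ≤ RainbowStars.hEdges s n 0 := by
      intro c' hc'
      rcases Nat.eq_zero_or_pos c' with rfl | h0
      · exact le_rfl
      · rcases hlt c' h0 hc' with h | ⟨hodd, hs, rfl⟩
        · exact h.le
        · exact (RainbowStars.hEdges_one_eq hs hc' hodd (by omega)).le
    constructor
    · rintro ⟨c, hc, hG, hcmax⟩
      rcases Nat.eq_zero_or_pos c with rfl | h0
      · exact Or.inl hG
      · rcases hlt c h0 hc with h | ⟨hodd, hs, rfl⟩
        · exact absurd (hcmax 0 (by omega)) (not_le.2 h)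
        · exact Or.inr ⟨hc, hodd, hs, hG⟩
    · rintro (hG | ⟨hk2, hodd, hs, hG⟩)
      · exact ⟨0, by omega, hG, hmax⟩
      · refine ⟨1, by omega, hG, ?_⟩
        rw [RainbowStars.hEdges_one_eq hs hk2 hodd (by omega)]
        exact hmax
  · intro h1 G
    rw [hN n (by omega) G]
    have hlt := fun c hc0 hc => RainbowStars.hEdges_lt_of_exists_eq_one (c := c) (n := n) hpos hmono
      h1 hc0 hc (by omega)
    have hcard : ∀ c < k, ∀ K : SimpleGraph (Fin n), RainbowStars.IsHGraph s c K →
        2 * K.edgeSet.ncard = RainbowStars.hEdges s n c := fun c hc K hK =>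
      hK.two_mul_ncard_edgeSet (by omega)
    constructor
    · rintro ⟨c, hc, hG, hcmax⟩
      refine ⟨?_, fun G' hG' => ?_⟩
      · by_cases h0 : c = 0
        · exact Or.inl (h0 ▸ hG)
        by_cases hlast : c = k - 1
        · exact Or.inr (Or.inl (hlast ▸ hG))
        rcases hlt c (by omega) (by omega) with h | h | ⟨hodd, hs, rfl, -⟩
        · exact absurd (hcmax 0 (by omega)) (not_le.2 h)
        · exact absurd (hcmax (k - 1) (by omega)) (not_le.2 h)
        · exact Or.inr (Or.inr ⟨by omega, hodd, hs, hG⟩)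
      · have h2 := hcard c hc G hG
        rcases hG' with hG' | hG'
        · have h3 := hcard 0 (by omega) G' hG'
          have h4 := hcmax 0 (by omega)
          omega
        · have h3 := hcard (k - 1) (by omega) G' hG'
          have h4 := hcmax (k - 1) (by omega)
          omega
    · rintro ⟨hG, hGmax⟩
      obtain ⟨c, hc, hGc⟩ : ∃ c < k, RainbowStars.IsHGraph s c G := by
        rcases hG with hG | hG | ⟨hk3, -, -, hG⟩
        · exact ⟨0, by omega, hG⟩
        · exact ⟨k - 1, by omega, hG⟩
        · exact ⟨1, by omega, hG⟩
      obtain ⟨K₀, hK₀⟩ := RainbowStars.exists_isHGraph s (Nat.zero_le n)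
      obtain ⟨K₁, hK₁⟩ := RainbowStars.exists_isHGraph s (show k - 1 ≤ n by omega)
      have h2 := hcard c hc G hGc
      have h3 := hcard 0 (by omega) K₀ hK₀
      have h4 := hcard (k - 1) (by omega) K₁ hK₁
      have h5 := hGmax K₀ (Or.inl hK₀)
      have h6 := hGmax K₁ (Or.inr hK₁)
      refine ⟨c, hc, hGc, fun c' hc' => ?_⟩
      by_cases h0 : c' = 0
      · subst h0
        omega
      by_cases hlast : c' = k - 1
      · subst hlast
        omega
      rcases hlt c' (by omega) (by omega) with h | h | ⟨-, -, -, h⟩ <;> omega
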